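/- Let $N\ge 1$, let $A=(A_{ij})_{1\le i,j\le N}$ be a non-random self-adjoint complex matrix with $|A_{ij}|\le a$ for all $i,j$, and let $\omega=(\omega_{ij})_{1\le i,j\le N}$ be complex random variables on a probability space $(\Omega,\mathbb P)$ with $\omega_{ij}=\overline{\omega_{ji}}$, such that $\{\omega_{ij}: i\le j\}$ are independent and, for $i\le j$, $\omega_{ij}$ has the law $P_{ij}$ of $u+\sqrt{-1}\,v$, where $u,v$ are independent real random variables with laws $P^R_{ij}$, $P^I_{ij}$. Let $\mathbf X_A(\omega)$ be the self-adjoint $N\times N$ matrix with entries $N^{-1/2}A_{ij}\omega_{ij}$. Write $\mathrm{tr}(M)=N^{-1}\sum_i M_{ii}$ and, for Lipschitz $f:\mathbb R\to\mathbb R$, $|f|_{\mathcal L}=\sup_{x\ne y}|f(x)-f(y)|/|x-y|$; $f(\mathbf X_A)$ is defined by functional calculus. (a) Let $K\subset\mathbb C$ be a compact set, of diameter $|K|$, with $P_{ij}(K^c)=0$ for all $1\le i\le j\le N$, and let $f$ be convex and Lipschitz. Then $\mathrm{tr} f(\mathbf X_A)$ is integrable and, with $\delta_0(N)=8|K|\sqrt{\pi}\,a|f|_{\mathcal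 L}/N$, for every $\delta>\delta_0(N)$, $$\mathbb P\big(|\mathrm{tr} f(\mathbf X_A)-\mathbb E[\mathrm{tr} f(\mathbf X_A)]|\ge\delta\big)\le 4\exp\Big(-\frac{1}{16|K|^2a^2|f|_{\mathcal L}^2}N^2(\delta-\delta_0(N))^2\Big).$$ (b) Suppose that for some $c$ all the laws $P^R_{ij}$, $P^I_{ij}$, $1\le i\le j\le N$, satisfy the logarithmic Sobolev inequality with constant $c$, that is, $\int g^2\log\big(g^2/\int g^2d\nu\big)d\nu\le 2c\int |g'|^2d\nu$ for every bounded $C^1$ function $g:\mathbb R\to\mathbb R$ with bounded derivative. Then, for every Lipschitz $f$, $\mathrm{tr} f(\mathbf X_A)$ is integrable and, for every $\delta>0$, $$\mathbb P\big(|\mathrm{tr} f(\mathbf X_A)-\mathbb E[\mathrm{tr} f(\mathbf X_A)]|\ge\delta\big)\le 2\exp\Big(-\frac{1}{8ca^2|f|_{\mathcal L}^2}N^2\delta^2\Big).$$ In the degenerate cases where a denominator vanishes, $1/0$ is read as $0$ and the bound is void. -/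

import Mathlib

open MeasureTheory ProbabilityTheory

noncomputable section

namespace MatrixConcentration

/-- The Lipschitz constant `sup_{x ≠ y} |f x - f y| / |x - y|` of a function on the real line. It is
used only for Lipschitz `f`, where the supremum is finite. -/
def lipConst (f : ℝ → ℝ) : ℝ :=
  ⨆ p : {p : ℝ × ℝ // p.1 ≠ p.2}, |f p.1.1 - f p.1.2| / |p.1.1 - p.1.2|

/-- The measure `ν` on the real line satisfies the logarithmic Sobolev inequality with constant `c`:
`∫ g² log (g² / ∫ g² dν) dν ≤ 2 c ∫ |g'|² dν`. The test functions are the bounded `C¹` functions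
with bounded derivative, so that for a finite measure all the integrals converge. -/
def LogSobolev (ν : Measure ℝ) (c : ℝ) : Prop :=
  ∀ g : ℝ → ℝ, ContDiff ℝ 1 g → (∃ M : ℝ, ∀ x, |g x| ≤ M) → (∃ M : ℝ, ∀ x, |deriv g x| ≤ M) →
    ∫ x, g x ^ 2 * Real.log (g x ^ 2 / ∫ y, g y ^ 2 ∂ν) ∂ν ≤ 2 * c * ∫ x, deriv g x ^ 2 ∂ν

/-- The law on `ℂ` of `u + i v`, where `u` has law `μR`, `v` has law `μI`, and `u`, `v` are
independent. -/
def entryLaw (μR μI : Measure ℝ) : Measure ℂ :=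
  (μR.prod μI).map fun q : ℝ × ℝ => (q.1 : ℂ) + Complex.I * (q.2 : ℂ)

/-- The matrix with entries `A i j * w i j / √N`. -/
def weightedMatrix {N : ℕ} (A : Matrix (Fin N) (Fin N) ℂ) (w : Fin N → Fin N → ℂ) :
    Matrix (Fin N) (Fin N) ℂ :=
  Matrix.of fun i j => ((1 / Real.sqrt N : ℝ) : ℂ) * A i j * w i j

/-- The normalized trace `N⁻¹ ∑ i, M i i`. -/
def normTrace {N : ℕ} (M : Matrix (Fin N) (Fin N) ℂ) : ℂ :=
  (N : ℂ)⁻¹ * M.trace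

/-- The normalized trace of `f (X)`, where `X` has entries `A i j * w i j / √N` and `f (X)` is given
by the functional calculus of self-adjoint matrices. -/
def spectralStat {N : ℕ} (f : ℝ → ℝ) (A : Matrix (Fin N) (Fin N) ℂ) (w : Fin N → Fin N → ℂ) : ℂ :=
  normTrace (cfc f (weightedMatrix A w))

/-- The weighted matrix is self-adjoint as soon as `A` and `w` are. -/
theorem weightedMatrix_isHermitian {N : ℕ} {A : Matrix (Fin N) (Fin N) ℂ}
    {w : Fin N → Fin N → ℂ} (hA : A.IsHermitian)
    (hw : ∀ i j, w i j = (starRingEnd ℂ) (w j i)) : (weightedMatrix A w).IsHermitian := by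
  ext i j
  have h1 := hA.apply i j
  simp only [RCLike.star_def] at h1
  simp only [Matrix.conjTranspose_apply, weightedMatrix, Matrix.of_apply, RCLike.star_def, map_mul,
    Complex.conj_ofReal, h1, ← hw i j]

end MatrixConcentration

end

/-! The normalized trace of `f (X)` averages `f` over the eigenvalues of `X`. Two Hermitian matrices
are compared through the doubly stochastic matrix of squared overlaps of their eigenbases: spectral
sums are Lipschitz for the Frobenius norm (`abs_sum_eigenvalues_sub_le`) and, for convex `f`, convex
in the matrix (`sum_eigenvalues_convex`). As a function of the independent entries on and above the
diagonal, the statistic is therefore Euclidean-Lipschitz with constant `√2 * a * lipConst f / N`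
(`euclideanLipschitz_upperStat`), and what remains is dimension-free concentration under product
measures.

For (a) this comes from Maurey's property (τ): if `h` is at most the infimal convolution of a convex
`f` with the cost, then `∫ exp h * ∫ exp (-f) ≤ 1`. It holds on a set of diameter `D` for the cost
`‖x‖² / (4 D²)` (`convexTau_of_bounded`) and passes to products (`ConvexTau.prod`). With `s F` for
`f` and `s F` minus a constant for `h`, Jensen's inequality then bounds the Laplace transform of `F`
centred at its mean, so that no shift `δ₀` arises.

For (b) subadditivity of entropy (`expEntropy_prod_le`) tensorizes the logarithmic Sobolev
inequality. Along `s ↦ s F` it becomes a differential inequality for the log-Laplace transform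
(Herbst), which gives a Gaussian bound for smooth bounded `F`; mollification and truncation reach
every Lipschitz `F`. Chernoff's bound concludes both parts, with better constants than those stated.
-/

namespace MatrixConcentration

/-! ### Spectral sums of Hermitian matrices. -/

section Trace

open Matrix

variable {n : Type*} [Fintype n] [DecidableEq n]

/-- The trace of `f (X)` for a Hermitian matrix is the sum of `f` over the eigenvalues. -/
theorem trace_cfc_eq_sum (f : ℝ → ℝ) {X : Matrix n n ℂ} (hX : X.IsHermitian) :
    (cfc f X).trace = ((∑ i, f (hX.eigenvalues i) : ℝ) : ℂ) := by
  rw [hX.cfc_eq, Matrix.IsHermitian.cfc, Unitary.conjStarAlgAut_apply, Matrix.trace_mul_cycle,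
    Unitary.coe_star_mul_self, one_mul, Matrix.trace_diagonal]
  simp

/-- Squared moduli of the overlaps between the eigenbases of two Hermitian matrices. -/
noncomputable def overlap {X Y : Matrix n n ℂ} (hX : X.IsHermitian) (hY : Y.IsHermitian)
    (i j : n) : ℝ :=
  ‖((star hX.eigenvectorUnitary * hY.eigenvectorUnitary : unitaryGroup n ℂ) : Matrix n n ℂ) i j‖ ^ 2

theorem sum_norm_sq_row (U : unitaryGroup n ℂ) (i : n) :
    ∑ j, ‖(U : Matrix n n ℂ) i j‖ ^ 2 = 1 := by
  have h := congrFun (congrFun (Unitary.coe_mul_star_self U) i) i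
  rw [Matrix.mul_apply] at h
  simp only [Unitary.coe_star, Matrix.star_apply, RCLike.star_def, Complex.mul_conj',
    one_apply_eq] at h
  exact_mod_cast h

theorem sum_norm_sq_col (U : unitaryGroup n ℂ) (j : n) :
    ∑ i, ‖(U : Matrix n n ℂ) i j‖ ^ 2 = 1 := by
  have h := congrFun (congrFun (Unitary.coe_star_mul_self U) j) j
  rw [Matrix.mul_apply] at h
  simp only [Matrix.star_apply, RCLike.star_def, Complex.conj_mul', one_apply_eq] at h
  exact_mod_cast h

variable {X Y : Matrix n n ℂ}

theorem overlap_nonneg (hX : X.IsHermitian) (hY : Y.IsHermitian) (i j : n) :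
    0 ≤ overlap hX hY i j := sq_nonneg _

theorem sum_overlap_right (hX : X.IsHermitian) (hY : Y.IsHermitian) (i : n) :
    ∑ j, overlap hX hY i j = 1 := sum_norm_sq_row _ i

theorem sum_overlap_left (hX : X.IsHermitian) (hY : Y.IsHermitian) (j : n) :
    ∑ i, overlap hX hY i j = 1 := sum_norm_sq_col _ j

/-- The diagonal of `Y` in the eigenbasis of `X` averages the eigenvalues of `Y` by the overlaps. -/
theorem conj_diag_eq (hX : X.IsHermitian) (hY : Y.IsHermitian) (i : n) :
    ((star hX.eigenvectorUnitary : Matrix n n ℂ) * Y * hX.eigenvectorUnitary) i i =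
      ((∑ j, overlap hX hY i j * hY.eigenvalues j : ℝ) : ℂ) := by
  set U : Matrix n n ℂ := (hX.eigenvectorUnitary : Matrix n n ℂ) with hU
  set V : Matrix n n ℂ := (hY.eigenvectorUnitary : Matrix n n ℂ) with hV
  have h : star U * Y * U =
      (star U * V) * diagonal (RCLike.ofReal ∘ hY.eigenvalues) * star (star U * V) := by
    conv_lhs => rw [hY.spectral_theorem, Unitary.conjStarAlgAut_apply]
    simp only [star_mul, star_star, mul_assoc, hV]
  rw [h, Matrix.mul_apply]
  push_cast
  refine Finset.sum_congr rfl fun j _ => ?_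
  rw [mul_diagonal, star_apply]
  have : ((overlap hX hY i j : ℝ) : ℂ) = (star U * V) i j * star ((star U * V) i j) := by
    rw [RCLike.star_def, Complex.mul_conj']
    simp [overlap, hU, hV]
  rw [this]
  simp only [Function.comp_apply, RCLike.ofReal_eq_complex_ofReal]
  ring

/-- The squared Frobenius distance is the overlap average of the squared eigenvalue differences. -/
theorem sum_overlap_mul_sq_sub (hX : X.IsHermitian) (hY : Y.IsHermitian) :
    ∑ i, ∑ j, overlap hX hY i j * (hX.eigenvalues i - hY.eigenvalues j) ^ 2 =
      ∑ i, ∑ j, ‖(X - Y) i j‖ ^ 2 := by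
  set U : Matrix n n ℂ := (hX.eigenvectorUnitary : Matrix n n ℂ) with hU
  set V : Matrix n n ℂ := (hY.eigenvectorUnitary : Matrix n n ℂ) with hV
  have hUU : U * star U = 1 := Unitary.coe_mul_star_self hX.eigenvectorUnitary
  have hUU' : star U * U = 1 := Unitary.coe_star_mul_self hX.eigenvectorUnitary
  have hVV : V * star V = 1 := Unitary.coe_mul_star_self hY.eigenvectorUnitary
  have hVV' : star V * V = 1 := Unitary.coe_star_mul_self hY.eigenvectorUnitary
  have hfro : ∀ M : Matrix n n ℂ,
      ((∑ i, ∑ j, ‖M i j‖ ^ 2 : ℝ) : ℂ) = (M * star M).trace := by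
    intro M
    simp [Matrix.trace, Matrix.mul_apply, Complex.mul_conj']
  -- Between the two eigenbases, `X - Y` has entries `(λ i - μ j) * (U* V) i j`; unitary invariance
  -- of the Frobenius norm does the rest.
  have hconj : star U * (X - Y) * V =
      diagonal (RCLike.ofReal ∘ hX.eigenvalues) * (star U * V) -
        (star U * V) * diagonal (RCLike.ofReal ∘ hY.eigenvalues) := by
    conv_lhs => rw [hX.spectral_theorem, hY.spectral_theorem, Unitary.conjStarAlgAut_apply,
      Unitary.conjStarAlgAut_apply]
    change star U * (U * _ * star U - V * _ * star V) * V = _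
    rw [mul_sub, sub_mul]
    congr 1
    · simp only [← mul_assoc, hUU', one_mul]
    · simp only [mul_assoc, hVV', mul_one]
  have hentry : ∀ i j, ‖(star U * (X - Y) * V) i j‖ ^ 2 =
      overlap hX hY i j * (hX.eigenvalues i - hY.eigenvalues j) ^ 2 := by
    intro i j
    rw [hconj, Matrix.sub_apply, diagonal_mul, mul_diagonal]
    simp only [Function.comp_apply, RCLike.ofReal_eq_complex_ofReal]
    have : (hX.eigenvalues i : ℂ) * (star U * V) i j - (star U * V) i j * (hY.eigenvalues j : ℂ) =
        (star U * V) i j * ((hX.eigenvalues i - hY.eigenvalues j : ℝ) : ℂ) := by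
      push_cast; ring
    rw [this, norm_mul, mul_pow, Complex.norm_real, Real.norm_eq_abs, sq_abs]
    simp [overlap, hU, hV]
  simp_rw [← hentry]
  have : ((∑ i, ∑ j, ‖(star U * (X - Y) * V) i j‖ ^ 2 : ℝ) : ℂ) =
      ((∑ i, ∑ j, ‖(X - Y) i j‖ ^ 2 : ℝ) : ℂ) := by
    rw [hfro, hfro]
    have h1 : star U * (X - Y) * V * star (star U * (X - Y) * V) =
        star U * ((X - Y) * star (X - Y)) * U := by
      simp only [star_mul, star_star]
      calc _ = star U * (X - Y) * (V * star V) * star (X - Y) * U := by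
            simp only [mul_assoc]
        _ = _ := by rw [hVV]; simp only [mul_assoc, mul_one]
    rw [h1, Matrix.trace_mul_cycle, hUU, one_mul]
  exact_mod_cast this

/-- Spectral sums of a Lipschitz function are Lipschitz for the Frobenius norm. -/
theorem abs_sum_eigenvalues_sub_le (hX : X.IsHermitian) (hY : Y.IsHermitian) {f : ℝ → ℝ} {L : ℝ}
    (hL : 0 ≤ L) (hf : ∀ x y, |f x - f y| ≤ L * |x - y|) :
    |∑ i, f (hX.eigenvalues i) - ∑ i, f (hY.eigenvalues i)| ≤
      L * √(Fintype.card n) * √(∑ i, ∑ j, ‖(X - Y) i j‖ ^ 2) := by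
  -- Double stochasticity writes both sums over the same weights, so no ordering or matching of
  -- eigenvalues is needed.
  have h1 : ∑ i, f (hX.eigenvalues i) = ∑ i, ∑ j, overlap hX hY i j * f (hX.eigenvalues i) := by
    refine Finset.sum_congr rfl fun i _ => ?_
    rw [← Finset.sum_mul, sum_overlap_right, one_mul]
  have h2 : ∑ i, f (hY.eigenvalues i) = ∑ i, ∑ j, overlap hX hY i j * f (hY.eigenvalues j) := by
    rw [Finset.sum_comm]
    refine Finset.sum_congr rfl fun i _ => ?_
    rw [← Finset.sum_mul, sum_overlap_left, one_mul]
  have hcard : ∑ i, ∑ j, overlap hX hY i j = Fintype.card n := by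
    simp [sum_overlap_right]
  rw [h1, h2, ← Finset.sum_sub_distrib]
  simp_rw [← Finset.sum_sub_distrib, ← mul_sub]
  calc |∑ i, ∑ j, overlap hX hY i j * (f (hX.eigenvalues i) - f (hY.eigenvalues j))|
      ≤ ∑ i, ∑ j, overlap hX hY i j * (L * |hX.eigenvalues i - hY.eigenvalues j|) := by
        refine (Finset.abs_sum_le_sum_abs _ _).trans (Finset.sum_le_sum fun i _ => ?_)
        refine (Finset.abs_sum_le_sum_abs _ _).trans (Finset.sum_le_sum fun j _ => ?_)
        rw [abs_mul, abs_of_nonneg (overlap_nonneg hX hY i j)]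
        exact mul_le_mul_of_nonneg_left (hf _ _) (overlap_nonneg hX hY i j)
    _ = L * ∑ p : n × n, √(overlap hX hY p.1 p.2) *
          (√(overlap hX hY p.1 p.2) * |hX.eigenvalues p.1 - hY.eigenvalues p.2|) := by
        rw [Fintype.sum_prod_type, Finset.mul_sum]
        refine Finset.sum_congr rfl fun i _ => ?_
        rw [Finset.mul_sum]
        refine Finset.sum_congr rfl fun j _ => ?_
        rw [← mul_assoc (√_), Real.mul_self_sqrt (overlap_nonneg hX hY i j)]
        ring
    _ ≤ L * (√(∑ p : n × n, √(overlap hX hY p.1 p.2) ^ 2) *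
          √(∑ p : n × n,
            (√(overlap hX hY p.1 p.2) * |hX.eigenvalues p.1 - hY.eigenvalues p.2|) ^ 2)) :=
        mul_le_mul_of_nonneg_left (Real.sum_mul_le_sqrt_mul_sqrt _ _ _) hL
    _ = _ := by
        rw [← sum_overlap_mul_sq_sub hX hY, ← hcard, mul_assoc]
        simp only [mul_pow, Real.sq_sqrt (overlap_nonneg hX hY _ _), sq_abs,
          Fintype.sum_prod_type]

/-- Peierls' inequality. -/
theorem sum_conj_diag_le (hX : X.IsHermitian) (hY : Y.IsHermitian) {f : ℝ → ℝ}
    (hf : ConvexOn ℝ Set.univ f) :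
    ∑ i, f (∑ j, overlap hX hY i j * hY.eigenvalues j) ≤ ∑ i, f (hY.eigenvalues i) := by
  calc ∑ i, f (∑ j, overlap hX hY i j * hY.eigenvalues j)
      ≤ ∑ i, ∑ j, overlap hX hY i j * f (hY.eigenvalues j) := by
        refine Finset.sum_le_sum fun i _ => ?_
        exact hf.map_sum_le (fun j _ => overlap_nonneg hX hY i j) (sum_overlap_right hX hY i)
          (fun _ _ => Set.mem_univ _)
    _ = _ := by
        rw [Finset.sum_comm]
        refine Finset.sum_congr rfl fun i _ => ?_
        rw [← Finset.sum_mul, sum_overlap_left, one_mul]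

/-- Klein's lemma: spectral sums of a convex function are convex. -/
theorem sum_eigenvalues_convex {Z : Matrix n n ℂ} (hX : X.IsHermitian) (hY : Y.IsHermitian)
    (hZ : Z.IsHermitian) {f : ℝ → ℝ} (hf : ConvexOn ℝ Set.univ f) {s t : ℝ} (hs : 0 ≤ s)
    (ht : 0 ≤ t) (hst : s + t = 1) (h : Z = (s : ℂ) • X + (t : ℂ) • Y) :
    ∑ i, f (hZ.eigenvalues i) ≤ s * ∑ i, f (hX.eigenvalues i) + t * ∑ i, f (hY.eigenvalues i) := by
  -- In the eigenbasis of `Z`, the diagonal of `Z` is linear in the diagonals of `X` and `Y`. Scalar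
  -- convexity separates these, and Peierls' inequality bounds each.
  have key : ∀ i, hZ.eigenvalues i = s * ∑ j, overlap hZ hX i j * hX.eigenvalues j +
      t * ∑ j, overlap hZ hY i j * hY.eigenvalues j := by
    intro i
    have h0 : ((star hZ.eigenvectorUnitary : Matrix n n ℂ) * Z * hZ.eigenvectorUnitary) i i =
        hZ.eigenvalues i := by
      have := hZ.conjStarAlgAut_star_eigenvectorUnitary
      rw [Unitary.conjStarAlgAut_apply] at this
      rw [Unitary.coe_star, star_star] at this
      rw [this]
      simp
    have h1 : ∀ U V : Matrix n n ℂ, V * Z * U = (s : ℂ) • (V * X * U) + (t : ℂ) • (V * Y * U) := by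
      intro U V
      rw [h, mul_add, add_mul, mul_smul_comm, mul_smul_comm, smul_mul_assoc, smul_mul_assoc]
    rw [h1, Matrix.add_apply, Matrix.smul_apply, Matrix.smul_apply, conj_diag_eq, conj_diag_eq]
      at h0
    simp only [smul_eq_mul] at h0
    exact_mod_cast h0.symm
  calc ∑ i, f (hZ.eigenvalues i)
      ≤ ∑ i, (s * f (∑ j, overlap hZ hX i j * hX.eigenvalues j) +
          t * f (∑ j, overlap hZ hY i j * hY.eigenvalues j)) := by
        refine Finset.sum_le_sum fun i _ => ?_
        rw [key i]
        exact hf.2 (Set.mem_univ _) (Set.mem_univ _) hs ht hst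
    _ ≤ _ := by
        rw [Finset.sum_add_distrib, ← Finset.mul_sum, ← Finset.mul_sum]
        exact add_le_add (mul_le_mul_of_nonneg_left (sum_conj_diag_le hZ hX hf) hs)
          (mul_le_mul_of_nonneg_left (sum_conj_diag_le hZ hY hf) ht)

end Trace

/-! ### Integrability under compactly supported measures. -/

section CompactSupport

variable {E : Type*} [TopologicalSpace E] [MeasurableSpace E]

/-- The measure gives no mass to the complement of some compact set. -/
def CompactlySupported (μ : Measure E) : Prop := ∃ K : Set E, IsCompact K ∧ μ Kᶜ = 0

theorem CompactlySupported.prod {F : Type*} [TopologicalSpace F] [MeasurableSpace F]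
    {μ : Measure E} {ν : Measure F} [SFinite μ] [SFinite ν] (hμ : CompactlySupported μ)
    (hν : CompactlySupported ν) : CompactlySupported (μ.prod ν) := by
  obtain ⟨K, hK, hK0⟩ := hμ
  obtain ⟨K', hK', hK'0⟩ := hν
  refine ⟨K ×ˢ K', hK.prod hK', ?_⟩
  rw [Set.compl_prod_eq_union]
  refine le_antisymm ((measure_union_le _ _).trans ?_) zero_le
  simp [Measure.prod_prod, hK0, hK'0]

theorem CompactlySupported.exists_ae_le {μ : Measure E} (h : CompactlySupported μ) {f : E → ℝ}
    (hf : Continuous f) : ∃ C, ∀ᵐ x ∂μ, ‖f x‖ ≤ C := by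
  obtain ⟨K, hK, hμ⟩ := h
  obtain ⟨C, hC⟩ := hK.exists_bound_of_continuousOn hf.continuousOn
  have hmem : ∀ᵐ x ∂μ, x ∈ K := mem_ae_iff.2 hμ
  exact ⟨C, hmem.mono hC⟩

variable [OpensMeasurableSpace E]

theorem CompactlySupported.integrable {μ : Measure E} [IsFiniteMeasure μ]
    (h : CompactlySupported μ) {f : E → ℝ} (hf : Continuous f) : Integrable f μ := by
  obtain ⟨C, hC⟩ := h.exists_ae_le hf
  exact Integrable.of_bound hf.measurable.aestronglyMeasurable C hC

/-- An upper bound on the exponent suffices, since the exponential is positive; `g` may be unbounded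
below. -/
theorem CompactlySupported.integrable_exp_of_le {μ : Measure E} [IsFiniteMeasure μ]
    (h : CompactlySupported μ) {f g : E → ℝ} (hf : Continuous f) (hg : Measurable g)
    (hgf : ∀ x, g x ≤ f x) : Integrable (fun x => Real.exp (g x)) μ := by
  refine (h.integrable (Real.continuous_exp.comp hf)).mono'
    (Real.measurable_exp.comp hg).aestronglyMeasurable (ae_of_all _ fun x => ?_)
  rw [Real.norm_eq_abs, abs_of_pos (Real.exp_pos _)]
  exact Real.exp_le_exp.2 (hgf x)

end CompactSupport

/-- Logarithmic integrals of exponentials are convex in the exponent. -/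
theorem log_integral_exp_convex {α : Type*} [MeasurableSpace α] {μ : Measure α}
    [IsProbabilityMeasure μ] {p q r : α → ℝ} (hp : Integrable (fun x => Real.exp (p x)) μ)
    (hq : Integrable (fun x => Real.exp (q x)) μ) (hr : Integrable (fun x => Real.exp (r x)) μ)
    {s t : ℝ} (hs : 0 ≤ s) (ht : 0 ≤ t) (hst : s + t = 1)
    (h : ∀ x, r x ≤ s * p x + t * q x) :
    Real.log (∫ x, Real.exp (r x) ∂μ) ≤
      s * Real.log (∫ x, Real.exp (p x) ∂μ) + t * Real.log (∫ x, Real.exp (q x) ∂μ) := by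
  set P := Real.log (∫ x, Real.exp (p x) ∂μ) with hP
  set Q := Real.log (∫ x, Real.exp (q x) ∂μ) with hQ
  have eP : Real.exp P = ∫ x, Real.exp (p x) ∂μ := Real.exp_log (integral_exp_pos hp)
  have eQ : Real.exp Q = ∫ x, Real.exp (q x) ∂μ := Real.exp_log (integral_exp_pos hq)
  rw [Real.log_le_iff_le_exp (integral_exp_pos hr)]
  -- Subtracting `P` and `Q` normalizes both integrals to one; pointwise convexity of `exp` then
  -- plays the role of Hölder's inequality.
  have hpt : ∀ x, Real.exp (r x) ≤ Real.exp (s * P + t * Q) *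
      (s * (Real.exp (p x) * Real.exp (-P)) + t * (Real.exp (q x) * Real.exp (-Q))) := by
    intro x
    have h1 := convexOn_exp.2 (Set.mem_univ (p x - P)) (Set.mem_univ (q x - Q)) hs ht hst
    simp only [smul_eq_mul] at h1
    rw [← Real.exp_add, ← Real.exp_add, ← sub_eq_add_neg, ← sub_eq_add_neg]
    refine le_trans ?_ (mul_le_mul_of_nonneg_left h1 (Real.exp_pos _).le)
    rw [← Real.exp_add]
    refine Real.exp_le_exp.2 ((h x).trans (le_of_eq ?_))
    ring
  calc ∫ x, Real.exp (r x) ∂μ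
      ≤ ∫ x, Real.exp (s * P + t * Q) *
          (s * (Real.exp (p x) * Real.exp (-P)) + t * (Real.exp (q x) * Real.exp (-Q))) ∂μ :=
        integral_mono hr ((((hp.mul_const _).const_mul _).add
          ((hq.mul_const _).const_mul _)).const_mul _) hpt
    _ = Real.exp (s * P + t * Q) := by
        rw [integral_const_mul, integral_add ((hp.mul_const _).const_mul _)
          ((hq.mul_const _).const_mul _), integral_const_mul, integral_const_mul,
          integral_mul_const, integral_mul_const, ← eP, ← eQ, ← Real.exp_add, ← Real.exp_add]
        simp [hst]

/-! ### Infimal convolution in one variable. -/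

section InfConvolution

variable {E F : Type*} [NormedAddCommGroup E] [NormedAddCommGroup F] {f : E × F → ℝ}
  {L : NNReal} {κ : ℝ}

/-- Partial infimal convolution with a quadratic cost in the first variable. -/
noncomputable def partialInfConv (κ : ℝ) (f : E × F → ℝ) (x : E × F) : ℝ :=
  ⨅ z : E, (f (x.1 - z, x.2) + κ * ‖z‖ ^ 2)

/-- The quadratic cost beats the linear decrease of `f`, by completing the square in `‖z‖`. Hence
the infimum is genuine and not a default value. -/
theorem bddBelow_partialInfConv (hκ : 0 < κ) (hL : LipschitzWith L f) (x : E × F) :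
    BddBelow (Set.range fun z : E => f (x.1 - z, x.2) + κ * ‖z‖ ^ 2) := by
  refine ⟨f x - L ^ 2 / (4 * κ), ?_⟩
  rintro _ ⟨z, rfl⟩
  have h1 := hL.le_add_mul x (x.1 - z, x.2)
  have h2 : dist x (x.1 - z, x.2) = ‖z‖ := by
    rw [Prod.dist_eq]; simp
  rw [h2] at h1
  have h3 : (L : ℝ) * ‖z‖ ≤ L ^ 2 / (4 * κ) + κ * ‖z‖ ^ 2 := by
    have : L ^ 2 / (4 * κ) + κ * ‖z‖ ^ 2 - (L : ℝ) * ‖z‖ = (L - 2 * κ * ‖z‖) ^ 2 / (4 * κ) := by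
      field_simp; ring
    have : 0 ≤ ((L : ℝ) - 2 * κ * ‖z‖) ^ 2 / (4 * κ) := by positivity
    linarith
  simp only
  linarith

theorem partialInfConv_le (hκ : 0 < κ) (hL : LipschitzWith L f) (x : E × F) (z : E) :
    partialInfConv κ f x ≤ f (x.1 - z, x.2) + κ * ‖z‖ ^ 2 :=
  ciInf_le (bddBelow_partialInfConv hκ hL x) z

theorem lipschitzWith_partialInfConv (hκ : 0 < κ) (hL : LipschitzWith L f) :
    LipschitzWith L (partialInfConv κ f) := by
  refine LipschitzWith.of_le_add_mul _ fun x y => ?_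
  rw [← sub_le_iff_le_add]
  refine le_ciInf fun z => ?_
  have h1 := partialInfConv_le hκ hL x z
  have h2 := hL.le_add_mul (x.1 - z, x.2) (y.1 - z, y.2)
  have h3 : dist (x.1 - z, x.2) (y.1 - z, y.2) = dist x y := by
    simp [Prod.dist_eq]
  rw [h3] at h2
  linarith

/-- Near-minimizers at `a` and at `b` differ; their convex combination is a competitor in between,
which is why joint convexity of `f` enters. -/
theorem partialInfConv_convex [NormedSpace ℝ E] [NormedSpace ℝ F] (hκ : 0 < κ)
    (hL : LipschitzWith L f) (hf : ConvexOn ℝ Set.univ f)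
    (x : E) (a b : F) {s t : ℝ} (hs : 0 ≤ s) (ht : 0 ≤ t) (hst : s + t = 1) :
    partialInfConv κ f (x, s • a + t • b) ≤
      s * partialInfConv κ f (x, a) + t * partialInfConv κ f (x, b) := by
  refine le_of_forall_pos_le_add fun ε hε => ?_
  obtain ⟨z, hz⟩ := exists_lt_of_ciInf_lt (lt_add_of_pos_right (partialInfConv κ f (x, a)) hε)
  obtain ⟨w, hw⟩ := exists_lt_of_ciInf_lt (lt_add_of_pos_right (partialInfConv κ f (x, b)) hε)
  have h1 := partialInfConv_le hκ hL (x, s • a + t • b) (s • z + t • w)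
  have h2 := hf.2 (Set.mem_univ (x - z, a)) (Set.mem_univ (x - w, b)) hs ht hst
  have h3 : s • (x - z, a) + t • (x - w, b) = (x - (s • z + t • w), s • a + t • b) := by
    ext1
    · simp only [Prod.fst_add, Prod.smul_fst]
      have : x = s • x + t • x := by rw [← add_smul, hst, one_smul]
      conv_rhs => rw [this]
      module
    · simp
  rw [h3] at h2
  have h4 : ‖s • z + t • w‖ ^ 2 ≤ s * ‖z‖ ^ 2 + t * ‖w‖ ^ 2 :=
    ((convexOn_norm convex_univ).pow (fun _ _ => norm_nonneg _) 2).2 (Set.mem_univ z)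
      (Set.mem_univ w) hs ht hst
  have h5 := mul_le_mul_of_nonneg_left h4 hκ.le
  have h6 := mul_le_mul_of_nonneg_left hz.le hs
  have h7 := mul_le_mul_of_nonneg_left hw.le ht
  simp only [smul_eq_mul] at h1 h2 h6 h7
  have h8 : s * ε + t * ε = ε := by rw [← add_mul, hst, one_mul]
  linarith

end InfConvolution

/-! ### Property (τ) on one factor and on products. -/

section ConvexTau

variable {E F : Type*} [NormedAddCommGroup E] [NormedSpace ℝ E] [MeasurableSpace E]
  [BorelSpace E] [NormedAddCommGroup F] [NormedSpace ℝ F] [MeasurableSpace F] [BorelSpace F]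

/-- Maurey's convex property `(τ)` for the cost `W`, restricted to Lipschitz functions. -/
def ConvexTau (μ : Measure E) (W : E → ℝ) : Prop :=
  ∀ f h : E → ℝ, ConvexOn ℝ Set.univ f → (∃ L, LipschitzWith L f) → Measurable h →
    (∀ x y, h x ≤ f y + W (x - y)) →
      (∫ x, Real.exp (h x) ∂μ) * ∫ x, Real.exp (-f x) ∂μ ≤ 1

/-- The left side is `2 exp (-u²/2) cosh (u - u²/2)`; use `cosh v ≤ exp (v²/2)` and `0 ≤ u - u²/2 ≤
u`. -/
theorem exp_sub_sq_add_exp_neg_le {u : ℝ} (h0 : 0 ≤ u) (h1 : u ≤ 1) :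
    Real.exp (u - u ^ 2) + Real.exp (-u) ≤ 2 := by
  have hc := Real.cosh_le_exp_half_sq (u - u ^ 2 / 2)
  rw [Real.cosh_eq] at hc
  have e1 : Real.exp (u - u ^ 2) = Real.exp (-(u ^ 2 / 2)) * Real.exp (u - u ^ 2 / 2) := by
    rw [← Real.exp_add]; ring_nf
  have e2 : Real.exp (-u) = Real.exp (-(u ^ 2 / 2)) * Real.exp (-(u - u ^ 2 / 2)) := by
    rw [← Real.exp_add]; ring_nf
  have hv : (u - u ^ 2 / 2) ^ 2 / 2 ≤ u ^ 2 / 2 := by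
    have : (u - u ^ 2 / 2) ^ 2 ≤ u ^ 2 := by
      apply pow_le_pow_left₀ <;> nlinarith
    linarith
  have h3 : Real.exp (-(u ^ 2 / 2)) * Real.exp ((u - u ^ 2 / 2) ^ 2 / 2) ≤ 1 := by
    rw [← Real.exp_add]
    exact Real.exp_le_one_iff.2 (by linarith)
  have h4 := mul_le_mul_of_nonneg_left hc (Real.exp_pos (-(u ^ 2 / 2))).le
  rw [e1, e2]
  linarith

/-- The parabola in `t` is minimal at `t = 2 u`, with value `u - u²`. If `u ≥ 1/2` this point leaves
the interval and `t = 1` gives `1/4`, the value of `u - u²` at `1/2`. -/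
theorem exp_add_exp_neg_le_two {u φ : ℝ} (hu : 0 ≤ u)
    (h : ∀ t ∈ Set.Icc (0 : ℝ) 1, φ ≤ (1 - t) * u + t ^ 2 / 4) :
    Real.exp φ + Real.exp (-u) ≤ 2 := by
  rcases le_total u (1 / 2) with h2 | h2
  · have := h (2 * u) ⟨by linarith, by linarith⟩
    have hφ : φ ≤ u - u ^ 2 := by nlinarith
    have := exp_sub_sq_add_exp_neg_le hu (by linarith)
    linarith [Real.exp_le_exp.2 hφ]
  · have hφ := h 1 ⟨by norm_num, le_rfl⟩
    have h1 : Real.exp φ ≤ Real.exp (1 / 2 - (1 / 2) ^ 2) :=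
      Real.exp_le_exp.2 (by linarith)
    have h3 : Real.exp (-u) ≤ Real.exp (-(1 / 2)) := Real.exp_le_exp.2 (by linarith)
    have := exp_sub_sq_add_exp_neg_le (u := 1 / 2) (by norm_num) (by norm_num)
    linarith

/-- A probability measure on a compact set of diameter at most `D` has the convex property `(τ)`
for the cost `‖x‖² / (4 D²)`. -/
theorem convexTau_of_bounded {μ : Measure E} [IsProbabilityMeasure μ] {K : Set E}
    (hK : IsCompact K) (hμ : μ Kᶜ = 0) {D : ℝ} (hD : 0 < D)
    (hKD : ∀ x ∈ K, ∀ y ∈ K, ‖x - y‖ ≤ D) :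
    ConvexTau μ (fun x => 1 / (4 * D ^ 2) * ‖x‖ ^ 2) := by
  rintro f h hf ⟨L, hL⟩ hh hhf
  have hne : K.Nonempty := by
    rw [Set.nonempty_iff_ne_empty]
    rintro rfl
    simp at hμ
  have hsupp : CompactlySupported μ := ⟨K, hK, hμ⟩
  obtain ⟨y₀, hy₀, hmin⟩ := hK.exists_isMinOn hne hL.continuous.continuousOn
  set m := f y₀ with hm
  have hfi : Integrable (fun x => Real.exp (-f x)) μ :=
    hsupp.integrable (Real.continuous_exp.comp hL.continuous.neg)
  have hle : ∀ x, h x ≤ f x := fun x => by simpa using hhf x x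
  have hhi : Integrable (fun x => Real.exp (h x)) μ :=
    hsupp.integrable_exp_of_le hL.continuous hh hle
  have key : ∀ x ∈ K, Real.exp (-m) * Real.exp (h x) ≤ 2 - Real.exp m * Real.exp (-f x) := by
    intro x hx
    -- The competitors are the points of the segment from `x` to the minimizer `y₀`; convexity
    -- bounds `f` there and the diameter bounds the cost by `t² / 4`.
    have := exp_add_exp_neg_le_two (u := f x - m) (φ := h x - m)
      (sub_nonneg.2 (hmin hx)) (fun t ht => by
        have h1 := hhf x ((1 - t) • x + t • y₀)
        have h2 := hf.2 (Set.mem_univ x) (Set.mem_univ y₀) (sub_nonneg.2 ht.2) ht.1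
          (sub_add_cancel 1 t)
        have h3 : x - ((1 - t) • x + t • y₀) = t • (x - y₀) := by module
        simp only [h3, norm_smul, Real.norm_eq_abs, abs_of_nonneg ht.1] at h1
        have h4 : 1 / (4 * D ^ 2) * (t * ‖x - y₀‖) ^ 2 ≤ t ^ 2 / 4 := by
          calc 1 / (4 * D ^ 2) * (t * ‖x - y₀‖) ^ 2 ≤ 1 / (4 * D ^ 2) * (t * D) ^ 2 := by
                have := hKD x hx y₀ hy₀
                have := ht.1
                gcongr
            _ = t ^ 2 / 4 := by field_simp
        simp only [smul_eq_mul] at h2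
        linarith)
    rw [← Real.exp_add, ← Real.exp_add]
    rw [show -m + h x = h x - m by ring, show m + -f x = -(f x - m) by ring]
    linarith
  have hint : Real.exp (-m) * ∫ x, Real.exp (h x) ∂μ ≤
      2 - Real.exp m * ∫ x, Real.exp (-f x) ∂μ := by
    calc Real.exp (-m) * ∫ x, Real.exp (h x) ∂μ = ∫ x, Real.exp (-m) * Real.exp (h x) ∂μ :=
          (integral_const_mul _ _).symm
      _ ≤ ∫ x, (2 - Real.exp m * Real.exp (-f x)) ∂μ := by
          refine integral_mono_ae (hhi.const_mul _)
            ((integrable_const _).sub (hfi.const_mul _)) ?_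
          filter_upwards [(mem_ae_iff.2 hμ : ∀ᵐ x ∂μ, x ∈ K)] with x hx using key x hx
      _ = _ := by
          rw [integral_sub (integrable_const _) (hfi.const_mul _), integral_const_mul]
          simp
  have e : Real.exp (-m) * Real.exp m = 1 := by rw [← Real.exp_add]; simp
  calc (∫ x, Real.exp (h x) ∂μ) * ∫ x, Real.exp (-f x) ∂μ
      = (Real.exp (-m) * ∫ x, Real.exp (h x) ∂μ) * (Real.exp m * ∫ x, Real.exp (-f x) ∂μ) := by
        rw [mul_mul_mul_comm, e, one_mul]
    _ ≤ (2 - Real.exp m * ∫ x, Real.exp (-f x) ∂μ) * (Real.exp m * ∫ x, Real.exp (-f x) ∂μ) := by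
        gcongr
    -- With `b` the second factor, this is `(2 - b) b ≤ 1`.
    _ ≤ 1 := by nlinarith [sq_nonneg (Real.exp m * ∫ x, Real.exp (-f x) ∂μ - 1)]

variable [SecondCountableTopologyEither E F]

/-- Tensorization of the convex property `(τ)`. -/
theorem ConvexTau.prod {μ : Measure E} {ν : Measure F} [IsProbabilityMeasure μ]
    [IsProbabilityMeasure ν] (hμc : CompactlySupported μ) (hνc : CompactlySupported ν) {κ : ℝ}
    (hκ : 0 < κ) {W : F → ℝ} (hW : W 0 = 0) (hμ : ConvexTau μ fun x => κ * ‖x‖ ^ 2)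
    (hν : ConvexTau ν W) :
    ConvexTau (μ.prod ν) fun x => κ * ‖x.1‖ ^ 2 + W x.2 := by
  rintro f h hf ⟨L, hL⟩ hh hhf
  have hc := hμc.prod hνc
  have hQL := lipschitzWith_partialInfConv hκ hL
  have hle : ∀ x, h x ≤ f x := fun x => by simpa [hW] using hhf x x
  have hfst : ∀ y : F, Continuous fun x : E => (x, y) := fun y => by fun_prop
  have hei : ∀ y, Integrable (fun x => Real.exp (partialInfConv κ f (x, y))) μ := fun y =>
    hμc.integrable (Real.continuous_exp.comp (hQL.continuous.comp (hfst y)))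
  have hhi : ∀ y, Integrable (fun x => Real.exp (h (x, y))) μ := fun y =>
    hμc.integrable_exp_of_le (f := fun x => f (x, y)) (hL.continuous.comp (hfst y))
      (hh.comp measurable_prodMk_right) (fun x => hle _)
  -- Integrating out the first variable gives a pair `g`, `k` admissible for (τ) under `ν`; (τ)
  -- under `μ`, at each fixed `y`, links `exp (-g)` to the integral of `exp (-f)`.
  set g : F → ℝ := fun y => Real.log (∫ x, Real.exp (partialInfConv κ f (x, y)) ∂μ) with hg
  set k : F → ℝ := fun y => Real.log (∫ x, Real.exp (h (x, y)) ∂μ) with hk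
  have eg : ∀ y, Real.exp (g y) = ∫ x, Real.exp (partialInfConv κ f (x, y)) ∂μ := fun y =>
    Real.exp_log (integral_exp_pos (hei y))
  have ek : ∀ y, Real.exp (k y) = ∫ x, Real.exp (h (x, y)) ∂μ := fun y =>
    Real.exp_log (integral_exp_pos (hhi y))
  have hgL : LipschitzWith L g := by
    refine LipschitzWith.of_le_add_mul _ fun a b => ?_
    rw [← Real.exp_le_exp, Real.exp_add, eg, eg, ← integral_mul_const]
    refine integral_mono (hei a) ((hei b).mul_const _) fun x => ?_
    rw [← Real.exp_add]
    refine Real.exp_le_exp.2 ?_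
    have := hQL.le_add_mul (x, a) (x, b)
    simpa [Prod.dist_eq] using this
  have hgc : ConvexOn ℝ Set.univ g := by
    refine ⟨convex_univ, fun a _ b _ s t hs ht hst => ?_⟩
    exact log_integral_exp_convex (hei a) (hei b) (hei _) hs ht hst
      fun x => partialInfConv_convex hκ hL hf x a b hs ht hst
  have hkm : Measurable k := by
    refine Real.measurable_log.comp ?_
    exact (Real.measurable_exp.comp hh).stronglyMeasurable.integral_prod_left'.measurable
  have hkg : ∀ x y, k x ≤ g y + W (x - y) := by
    intro a b
    rw [← Real.exp_le_exp, Real.exp_add, ek, eg, ← integral_mul_const]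
    refine integral_mono (hhi a) ((hei b).mul_const _) fun x => ?_
    rw [← Real.exp_add]
    refine Real.exp_le_exp.2 ?_
    rw [← sub_le_iff_le_add]
    refine le_ciInf fun z => ?_
    have := hhf (x, a) (x - z, b)
    simp only [Prod.mk_sub_mk, sub_sub_cancel] at this
    simp only
    linarith
  have h1 := hν g k hgc ⟨L, hgL⟩ hkm hkg
  have hfi : Integrable (fun x => Real.exp (-f x)) (μ.prod ν) :=
    hc.integrable (Real.continuous_exp.comp hL.continuous.neg)
  have e1 : ∫ x, Real.exp (h x) ∂(μ.prod ν) = ∫ y, Real.exp (k y) ∂ν := by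
    rw [integral_prod_symm _ (hc.integrable_exp_of_le hL.continuous hh hle)]
    simp_rw [ek]
  have e2 : ∫ x, Real.exp (-f x) ∂(μ.prod ν) ≤ ∫ y, Real.exp (-g y) ∂ν := by
    rw [integral_prod_symm _ hfi]
    refine integral_mono hfi.integral_prod_right
      (hνc.integrable (Real.continuous_exp.comp hgL.continuous.neg)) fun y => ?_
    have h2 := hμ (fun x => f (x, y)) (fun x => partialInfConv κ f (x, y))
      ⟨convex_univ, fun a _ b _ s t hs ht hst => by
        have := hf.2 (Set.mem_univ (a, y)) (Set.mem_univ (b, y)) hs ht hst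
        have e : s • (a, y) + t • (b, y) = (s • a + t • b, y) := by
          ext1
          · simp
          · simp [← add_smul, hst]
        rwa [e] at this⟩
      ⟨L, LipschitzWith.of_le_add_mul _ fun a b => by
        simpa [Prod.dist_eq] using hL.le_add_mul (a, y) (b, y)⟩
      (hQL.continuous.comp (hfst y)).measurable
      (fun a b => by simpa using partialInfConv_le hκ hL (a, y) (a - b))
    rw [← eg] at h2
    simp only
    rw [Real.exp_neg, ← one_div, le_div_iff₀' (Real.exp_pos _)]
    exact h2
  rw [e1]
  exact (mul_le_mul_of_nonneg_left e2 (integral_nonneg fun _ => (Real.exp_pos _).le)).trans h1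

end ConvexTau

/-! ### Two general estimates: a two-sided tail and Jensen's inequality. -/

section Subgaussian

variable {Ω : Type*} [MeasurableSpace Ω] {μ : Measure Ω} [IsProbabilityMeasure μ]

/-- Two-sided tail bound for sub-Gaussian variables. -/
theorem measureReal_le_abs_le_of_hasSubgaussianMGF {X : Ω → ℝ} {c : NNReal}
    (h : HasSubgaussianMGF X c μ) {δ : ℝ} (hδ : 0 ≤ δ) :
    μ.real {x | δ ≤ |X x|} ≤ 2 * Real.exp (-δ ^ 2 / (2 * c)) := by
  have h1 := h.measure_ge_le hδ
  have h2 := h.neg.measure_ge_le hδ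
  have hsub : {x | δ ≤ |X x|} ⊆ {x | δ ≤ X x} ∪ {x | δ ≤ (-X) x} := by
    intro x hx
    rcases le_abs.1 (show δ ≤ |X x| from hx) with h | h
    · exact Or.inl h
    · exact Or.inr h
  calc μ.real {x | δ ≤ |X x|} ≤ μ.real ({x | δ ≤ X x} ∪ {x | δ ≤ (-X) x}) :=
        measureReal_mono hsub
    _ ≤ μ.real {x | δ ≤ X x} + μ.real {x | δ ≤ (-X) x} := measureReal_union_le _ _
    _ ≤ _ := by linarith

theorem exp_integral_le_integral_exp {X : Ω → ℝ} (h1 : Integrable X μ)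
    (h2 : Integrable (fun x => Real.exp (X x)) μ) :
    Real.exp (∫ x, X x ∂μ) ≤ ∫ x, Real.exp (X x) ∂μ :=
  convexOn_exp.map_integral_le Real.continuous_exp.continuousOn isClosed_univ
    (ae_of_all _ fun _ => Set.mem_univ _) h1 h2

end Subgaussian

/-! ### Concentration of convex functions of bounded independent variables. -/

section ConvexConcentration

theorem CompactlySupported.pi {n : ℕ} {μ : Fin n → Measure ℂ} [∀ i, IsProbabilityMeasure (μ i)]
    {K : Set ℂ} (hK : IsCompact K) (hμ : ∀ i, μ i Kᶜ = 0) :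
    CompactlySupported (Measure.pi μ) := by
  refine ⟨Set.univ.pi fun _ => K, isCompact_univ_pi fun _ => hK, ?_⟩
  have h : ∀ᵐ x ∂(Measure.pi μ), ∀ i, x i ∈ K := by
    rw [ae_all_iff]
    intro i
    exact (measurePreserving_eval μ i).quasiMeasurePreserving.ae (mem_ae_iff.2 (hμ i))
  refine mem_ae_iff.1 (h.mono fun x hx => ?_)
  exact fun i _ => hx i

/-- A splitting that is at once linear and measure preserving transports convexity, differentials
and integrals in the inductions on the number of coordinates. -/
theorem measurePreserving_consEquivL {n : ℕ} (μ : Fin (n + 1) → Measure ℂ)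
    [∀ i, IsProbabilityMeasure (μ i)] :
    MeasurePreserving (Fin.consEquivL ℝ fun _ : Fin (n + 1) => ℂ)
      ((μ 0).prod (Measure.pi fun i => μ (Fin.succ i))) (Measure.pi μ) := by
  have h := (measurePreserving_piFinSuccAbove μ 0).symm (MeasurableEquiv.piFinSuccAbove _ 0)
  convert! h using 1
  funext x
  exact (Fin.insertNth_zero' x.1 x.2).symm

theorem convexTau_pi {K : Set ℂ} (hK : IsCompact K) {D : ℝ} (hD : 0 < D)
    (hKD : ∀ x ∈ K, ∀ y ∈ K, ‖x - y‖ ≤ D) {n : ℕ} (μ : Fin n → Measure ℂ)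
    [∀ i, IsProbabilityMeasure (μ i)] (hμ : ∀ i, μ i Kᶜ = 0) :
    ConvexTau (Measure.pi μ) fun x => 1 / (4 * D ^ 2) * ∑ i, ‖x i‖ ^ 2 := by
  induction n with
  | zero =>
    rintro f h - - - hhf
    rw [Measure.pi_of_empty μ 0, integral_dirac, integral_dirac, ← Real.exp_add]
    refine Real.exp_le_one_iff.2 ?_
    simpa using hhf 0 0
  | succ n ih =>
    rintro f h hf ⟨L, hL⟩ hh hhf
    let e := Fin.consEquivL ℝ (fun _ : Fin (n + 1) => ℂ)
    have hmp : MeasurePreserving e ((μ 0).prod (Measure.pi fun i => μ (Fin.succ i)))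
        (Measure.pi μ) := measurePreserving_consEquivL μ
    have hemb : MeasurableEmbedding e := e.toHomeomorph.measurableEmbedding
    have hprod := ConvexTau.prod (μ := μ 0) (ν := Measure.pi fun i => μ (Fin.succ i))
      ⟨K, hK, hμ 0⟩ (CompactlySupported.pi hK fun i => hμ _)
      (κ := 1 / (4 * D ^ 2)) (by positivity) (by simp)
      (convexTau_of_bounded hK (hμ 0) hD hKD) (ih (fun i => μ (Fin.succ i)) fun i => hμ _)
    rw [← hmp.integral_comp hemb, ← hmp.integral_comp hemb]
    refine hprod (f ∘ e) (h ∘ e) (hf.comp_linearMap e.toLinearEquiv.toLinearMap)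
      ⟨_, hL.comp e.lipschitz⟩ (hh.comp hemb.measurable) fun x y => ?_
    refine (hhf (e x) (e y)).trans (le_of_eq ?_)
    simp only [Function.comp_apply, Fin.sum_univ_succ, mul_add]
    rfl

/-- A function on `ℂⁿ` is `Λ`-Lipschitz for the Euclidean norm. -/
def EuclideanLipschitz {n : ℕ} (Λ : ℝ) (F : (Fin n → ℂ) → ℝ) : Prop :=
  ∀ x y, |F x - F y| ≤ Λ * √(∑ i, ‖x i - y i‖ ^ 2)

theorem sqrt_sum_norm_sq_le {n : ℕ} (x : Fin n → ℂ) :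
    √(∑ i, ‖x i‖ ^ 2) ≤ √n * ‖x‖ := by
  refine Real.sqrt_le_iff.2 ⟨by positivity, ?_⟩
  rw [mul_pow, Real.sq_sqrt (Nat.cast_nonneg n)]
  calc ∑ i, ‖x i‖ ^ 2 ≤ ∑ _i : Fin n, ‖x‖ ^ 2 := by
        gcongr with i
        exact norm_le_pi_norm x i
    _ = _ := by simp

/-- The ambient norm is the supremum norm. The lossy `√n` serves only qualitative purposes
(continuity, finiteness of bounds, smoothing radius) and never reaches the final constants. -/
theorem EuclideanLipschitz.lipschitzWith {n : ℕ} {Λ : ℝ} (hΛ : 0 ≤ Λ) {F : (Fin n → ℂ) → ℝ}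
    (hF : EuclideanLipschitz Λ F) : LipschitzWith (Real.toNNReal (Λ * √n)) F := by
  refine LipschitzWith.of_dist_le_mul fun x y => ?_
  rw [Real.dist_eq, Real.coe_toNNReal _ (by positivity), dist_eq_norm, mul_assoc]
  exact (hF x y).trans (mul_le_mul_of_nonneg_left (sqrt_sum_norm_sq_le (x - y)) hΛ)

theorem EuclideanLipschitz.const_mul {n : ℕ} {Λ : ℝ} {F : (Fin n → ℂ) → ℝ}
    (hF : EuclideanLipschitz Λ F) (s : ℝ) : EuclideanLipschitz (|s| * Λ) fun x => s * F x := by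
  intro x y
  rw [← mul_sub, abs_mul, mul_assoc]
  exact mul_le_mul_of_nonneg_left (hF x y) (abs_nonneg s)

/-- Convex Lipschitz functions of independent bounded variables are sub-Gaussian. -/
theorem hasSubgaussianMGF_of_convex {K : Set ℂ} (hK : IsCompact K) {D : ℝ} (hD : 0 < D)
    (hKD : ∀ x ∈ K, ∀ y ∈ K, ‖x - y‖ ≤ D) {n : ℕ} (μ : Fin n → Measure ℂ)
    [∀ i, IsProbabilityMeasure (μ i)] (hμ : ∀ i, μ i Kᶜ = 0) {F : (Fin n → ℂ) → ℝ} {Λ : ℝ}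
    (hΛ : 0 ≤ Λ) (hF : EuclideanLipschitz Λ F) (hconv : ConvexOn ℝ Set.univ F) :
    HasSubgaussianMGF (fun x => F x - ∫ y, F y ∂(Measure.pi μ))
      (Real.toNNReal (2 * Λ ^ 2 * D ^ 2)) (Measure.pi μ) := by
  set ν := Measure.pi μ with hν
  have hc : CompactlySupported ν := CompactlySupported.pi hK hμ
  have hFc : Continuous F := (hF.lipschitzWith hΛ).continuous
  have hFi : Integrable F ν := hc.integrable hFc
  have hexp : ∀ (s b : ℝ), Integrable (fun x => Real.exp (s * F x + b)) ν := fun s b =>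
    hc.integrable (by fun_prop)
  have key : ∀ s : ℝ, 0 ≤ s →
      (∫ x, Real.exp (s * F x) ∂ν) * (∫ x, Real.exp (-(s * F x)) ∂ν) ≤
        Real.exp (s ^ 2 * Λ ^ 2 * D ^ 2) := by
    intro s hs
    have hsF : EuclideanLipschitz (s * Λ) fun x => s * F x := by
      simpa [abs_of_nonneg hs] using hF.const_mul s
    -- The constant subtracted is the maximum over `r` of `s Λ r - r² / (4 D²)`.
    have h1 := convexTau_pi hK hD hKD μ hμ (fun x => s * F x)
      (fun x => s * F x + -(s ^ 2 * Λ ^ 2 * D ^ 2)) (hconv.smul hs)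
      ⟨_, hsF.lipschitzWith (by positivity)⟩ (by fun_prop) fun x y => by
        have h2 := (le_abs_self _).trans (hsF x y)
        set r := √(∑ i, ‖x i - y i‖ ^ 2) with hr
        have h3 : ∑ i, ‖(x - y) i‖ ^ 2 = r ^ 2 := by
          rw [hr, Real.sq_sqrt (by positivity)]; rfl
        simp only [h3] at h2 ⊢
        have h4 : s ^ 2 * Λ ^ 2 * D ^ 2 + 1 / (4 * D ^ 2) * r ^ 2 - s * Λ * r =
            (s * Λ * D - r / (2 * D)) ^ 2 := by
          field_simp; ring
        linarith [sq_nonneg (s * Λ * D - r / (2 * D))]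
    simp_rw [Real.exp_add, integral_mul_const] at h1
    rw [Real.exp_neg (s ^ 2 * Λ ^ 2 * D ^ 2), mul_right_comm, ← div_eq_mul_inv,
      div_le_one (Real.exp_pos _)] at h1
    exact h1
  have hlow : ∀ s : ℝ, Real.exp (s * ∫ x, F x ∂ν) ≤ ∫ x, Real.exp (s * F x) ∂ν := fun s => by
    rw [← integral_const_mul]
    exact exp_integral_le_integral_exp (hFi.const_mul s) (by simpa using hexp s 0)
  have hup : ∀ s : ℝ, (∫ x, Real.exp (s * F x) ∂ν) * Real.exp (-(s * ∫ x, F x ∂ν)) ≤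
      Real.exp (s ^ 2 * Λ ^ 2 * D ^ 2) := by
    intro s
    -- Jensen turns the factor with `-s F` into centring at the mean. The product is symmetric in
    -- the sign of `s`, which covers negative `s`.
    have hle : Real.exp (-(s * ∫ x, F x ∂ν)) ≤ ∫ x, Real.exp (-(s * F x)) ∂ν := by
      simpa using hlow (-s)
    refine (mul_le_mul_of_nonneg_left hle (integral_nonneg fun _ => (Real.exp_pos _).le)).trans ?_
    rcases le_total 0 s with hs | hs
    · exact key s hs
    · have := key (-s) (neg_nonneg.2 hs)
      rw [mul_comm]
      simpa using this
  refine ⟨fun t => ?_, fun t => ?_⟩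
  · simpa only [sub_eq_add_neg, mul_add, mul_neg] using hexp t (-(t * ∫ x, F x ∂ν))
  · rw [mgf, Real.coe_toNNReal _ (by positivity)]
    calc ∫ x, Real.exp (t * (F x - ∫ y, F y ∂ν)) ∂ν
        = (∫ x, Real.exp (t * F x) ∂ν) * Real.exp (-(t * ∫ x, F x ∂ν)) := by
          rw [← integral_mul_const]
          congr 1 with x
          rw [← Real.exp_add]
          ring_nf
      _ ≤ _ := (hup t).trans (le_of_eq (by ring_nf))

end ConvexConcentration

/-! ### Entropy: variational inequality and subadditivity. -/

section Entropy

variable {E F : Type*} [MeasurableSpace E] [MeasurableSpace F]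

/-- The entropy of `exp G`. -/
noncomputable def expEntropy (μ : Measure E) (G : E → ℝ) : ℝ :=
  ∫ x, Real.exp (G x) * (G x - Real.log (∫ y, Real.exp (G y) ∂μ)) ∂μ

theorem integrable_of_abs_le {μ : Measure E} [IsFiniteMeasure μ] {G : E → ℝ} {M : ℝ}
    (hG : Measurable G) (hM : ∀ x, |G x| ≤ M) : Integrable G μ :=
  Integrable.of_bound hG.aestronglyMeasurable M (ae_of_all _ hM)

theorem abs_exp_mul_le {a b A B : ℝ} (ha : |a| ≤ A) (hb : |b| ≤ B) :
    |Real.exp a * b| ≤ Real.exp A * B := by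
  rw [abs_mul, Real.abs_exp]
  exact mul_le_mul (Real.exp_le_exp.2 ((le_abs_self a).trans ha)) hb (abs_nonneg _)
    (Real.exp_pos _).le

theorem integrable_exp_of_abs_le {μ : Measure E} [IsFiniteMeasure μ] {G : E → ℝ} {M : ℝ}
    (hG : Measurable G) (hM : ∀ x, |G x| ≤ M) : Integrable (fun x => Real.exp (G x)) μ :=
  integrable_of_abs_le (M := Real.exp M) (by fun_prop) fun x => by
    rw [Real.abs_exp]
    exact Real.exp_le_exp.2 (le_of_abs_le (hM x))

theorem abs_log_integral_exp_le {μ : Measure E} [IsProbabilityMeasure μ] {G : E → ℝ} {M : ℝ}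
    (hG : Measurable G) (hM : ∀ x, |G x| ≤ M) :
    |Real.log (∫ y, Real.exp (G y) ∂μ)| ≤ M := by
  have hi : Integrable (fun y => Real.exp (G y)) μ :=
    integrable_exp_of_abs_le (by fun_prop) fun x => hM x
  have hpos := integral_exp_pos hi
  rw [abs_le]
  constructor
  · rw [Real.le_log_iff_exp_le hpos]
    calc Real.exp (-M) = ∫ _x, Real.exp (-M) ∂μ := by simp
      _ ≤ _ := integral_mono (integrable_const _) hi fun x =>
          Real.exp_le_exp.2 (neg_le_of_abs_le (hM x))
  · rw [Real.log_le_iff_le_exp hpos]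
    calc _ ≤ ∫ _x, Real.exp M ∂μ := integral_mono hi (integrable_const _) fun x =>
          Real.exp_le_exp.2 (le_of_abs_le (hM x))
      _ = _ := by simp

/-- The variational inequality for the entropy. -/
theorem integral_exp_mul_le_expEntropy {μ : Measure E} [IsProbabilityMeasure μ] {G H : E → ℝ}
    {M M' : ℝ} (hG : Measurable G) (hM : ∀ x, |G x| ≤ M) (hH : Measurable H)
    (hM' : ∀ x, |H x| ≤ M') (h1 : ∫ x, Real.exp (H x) ∂μ = 1) :
    ∫ x, Real.exp (G x) * H x ∂μ ≤ expEntropy μ G := by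
  set I := ∫ x, Real.exp (G x) ∂μ with hI
  have hGi : Integrable (fun x => Real.exp (G x)) μ :=
    integrable_exp_of_abs_le (by fun_prop) fun x => hM x
  have hHi : Integrable (fun x => Real.exp (H x)) μ :=
    integrable_exp_of_abs_le (by fun_prop) fun x => hM' x
  have hIpos : 0 < I := integral_exp_pos hGi
  have i1 : Integrable (fun x => Real.exp (G x) * H x) μ :=
    integrable_of_abs_le (by fun_prop) fun x => abs_exp_mul_le (hM x) (hM' x)
  have i2 : Integrable (fun x => Real.exp (G x) * (G x - Real.log I)) μ :=
    integrable_of_abs_le (by fun_prop) fun x => abs_exp_mul_le (hM x)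
      ((abs_sub _ _).trans (add_le_add (hM x) (abs_log_integral_exp_le hG hM)))
  have i3 : Integrable (fun x => I * Real.exp (H x) - Real.exp (G x)) μ :=
    (hHi.const_mul _).sub hGi
  -- This is `1 + u ≤ exp u` at `u = H - G + log I`, multiplied by `exp G`.
  have hpt : ∀ x, Real.exp (G x) * H x ≤
      Real.exp (G x) * (G x - Real.log I) + (I * Real.exp (H x) - Real.exp (G x)) := by
    intro x
    have h2 := Real.add_one_le_exp (H x - G x + Real.log I)
    have h3 := mul_le_mul_of_nonneg_left h2 (Real.exp_pos (G x)).le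
    rw [Real.exp_add, Real.exp_log hIpos, Real.exp_sub] at h3
    have h4 : Real.exp (G x) * (Real.exp (H x) / Real.exp (G x) * I) = I * Real.exp (H x) := by
      field_simp
    rw [h4] at h3
    linarith
  calc ∫ x, Real.exp (G x) * H x ∂μ
      ≤ ∫ x, (Real.exp (G x) * (G x - Real.log I) + (I * Real.exp (H x) - Real.exp (G x))) ∂μ :=
        integral_mono i1 (i2.add i3) hpt
    _ = expEntropy μ G := by
        rw [integral_add i2 i3, integral_sub (hHi.const_mul _) hGi,
          integral_const_mul, h1, ← hI, mul_one, sub_self, add_zero]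
        rfl

/-- Subadditivity of the entropy on a product of two probability spaces. -/
theorem expEntropy_prod_le {μ : Measure E} {ν : Measure F} [IsProbabilityMeasure μ]
    [IsProbabilityMeasure ν] {G : E × F → ℝ} {M : ℝ} (hG : Measurable G)
    (hM : ∀ x, |G x| ≤ M) :
    Integrable (fun y => expEntropy μ fun x => G (x, y)) ν ∧
    Integrable (fun x => expEntropy ν fun y => G (x, y)) μ ∧
    expEntropy (μ.prod ν) G ≤
      ∫ y, expEntropy μ (fun x => G (x, y)) ∂ν + ∫ x, expEntropy ν (fun y => G (x, y)) ∂μ := by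
  set k : F → ℝ := fun y => Real.log (∫ x, Real.exp (G (x, y)) ∂μ) with hk
  set l : E → ℝ := fun x => Real.log (∫ y, Real.exp (G (x, y)) ∂ν) with hl
  set I := Real.log (∫ z, Real.exp (G z) ∂(μ.prod ν)) with hI
  have hexpG : Measurable fun z => Real.exp (G z) := by fun_prop
  have hkm : Measurable k := Real.measurable_log.comp
    hexpG.stronglyMeasurable.integral_prod_left'.measurable
  have hlm : Measurable l := Real.measurable_log.comp
    hexpG.stronglyMeasurable.integral_prod_right'.measurable
  have hGx : ∀ y, Measurable fun x => G (x, y) := fun y => by fun_prop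
  have hGy : ∀ x, Measurable fun y => G (x, y) := fun x => by fun_prop
  have hkM : ∀ y, |k y| ≤ M := fun y => abs_log_integral_exp_le (hGx y) fun x => hM _
  have hlM : ∀ x, |l x| ≤ M := fun x => abs_log_integral_exp_le (hGy x) fun y => hM _
  have hIM : |I| ≤ M := abs_log_integral_exp_le hG hM
  have i0 : Integrable (fun z => Real.exp (G z)) (μ.prod ν) :=
    integrable_exp_of_abs_le (by fun_prop) fun x => hM x
  have ix : ∀ y, Integrable (fun x => Real.exp (G (x, y))) μ := fun y =>
    integrable_exp_of_abs_le (by fun_prop) fun x => hM (x, y)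
  have i1 : Integrable (fun z : E × F => Real.exp (G z) * (G z - k z.2)) (μ.prod ν) :=
    integrable_of_abs_le (by fun_prop) fun z => abs_exp_mul_le (hM z)
      ((abs_sub _ _).trans (add_le_add (hM z) (hkM z.2)))
  have i2 : Integrable (fun z : E × F => Real.exp (G z) * (k z.2 - I)) (μ.prod ν) :=
    integrable_of_abs_le (by fun_prop) fun z => abs_exp_mul_le (hM z)
      ((abs_sub _ _).trans (add_le_add (hkM z.2) hIM))
  have i3 : Integrable (fun z : E × F => Real.exp (G z) * (G z - l z.1)) (μ.prod ν) :=
    integrable_of_abs_le (by fun_prop) fun z => abs_exp_mul_le (hM z)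
      ((abs_sub _ _).trans (add_le_add (hM z) (hlM z.1)))
  have i4 : Integrable (fun x => expEntropy ν fun y => G (x, y)) μ := i3.integral_prod_left
  refine ⟨i1.integral_prod_right, i4, ?_⟩
  -- By Fubini, `k - I` is a normalized exponent, hence admissible in the variational inequality for
  -- each section `G (x, ·)`.
  have hH1 : ∫ y, Real.exp (k y - I) ∂ν = 1 := by
    have : ∀ y, Real.exp (k y - I) = (∫ x, Real.exp (G (x, y)) ∂μ) * Real.exp (-I) := by
      intro y
      rw [sub_eq_add_neg, Real.exp_add, hk, Real.exp_log (integral_exp_pos (ix y))]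
    simp_rw [this]
    rw [integral_mul_const, ← integral_prod_symm _ i0, Real.exp_neg,
      Real.exp_log (integral_exp_pos i0)]
    exact mul_inv_cancel₀ (integral_exp_pos i0).ne'
  calc expEntropy (μ.prod ν) G
      = ∫ z, (Real.exp (G z) * (G z - k z.2) + Real.exp (G z) * (k z.2 - I)) ∂(μ.prod ν) := by
        rw [expEntropy]
        congr 1 with z
        ring
    _ = ∫ y, expEntropy μ (fun x => G (x, y)) ∂ν +
          ∫ x, ∫ y, Real.exp (G (x, y)) * (k y - I) ∂ν ∂μ := by
        rw [integral_add i1 i2, integral_prod_symm _ i1, integral_prod _ i2]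
        rfl
    _ ≤ _ := by
        refine add_le_add le_rfl (integral_mono i2.integral_prod_left i4 fun x => ?_)
        exact integral_exp_mul_le_expEntropy (hGy x) (fun y => hM _) (by fun_prop)
          (fun y => (abs_sub _ _).trans (add_le_add (hkM y) hIM)) hH1

end Entropy

/-! ### Tensorization of the logarithmic Sobolev inequality. -/

section GradientLSI

variable {E F : Type*} [NormedAddCommGroup E] [NormedSpace ℝ E] [NormedAddCommGroup F]
  [NormedSpace ℝ F]

/-- A continuous function on the dual with at most quadratic growth. -/
def QuadraticGrowth (q : (E →L[ℝ] ℝ) → ℝ) : Prop :=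
  Continuous q ∧ ∃ C : ℝ, ∀ l, |q l| ≤ C * ‖l‖ ^ 2

theorem quadraticGrowth_apply_sq (v : E) : QuadraticGrowth fun l : E →L[ℝ] ℝ => l v ^ 2 := by
  refine ⟨by fun_prop, ‖v‖ ^ 2, fun l => ?_⟩
  rw [abs_pow, ← Real.norm_eq_abs, ← mul_pow, mul_comm ‖v‖]
  exact pow_le_pow_left₀ (norm_nonneg _) (l.le_opNorm v) 2

theorem QuadraticGrowth.add {q q' : (E →L[ℝ] ℝ) → ℝ} (h : QuadraticGrowth q)
    (h' : QuadraticGrowth q') : QuadraticGrowth fun l => q l + q' l := by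
  obtain ⟨h, C, hC⟩ := h
  obtain ⟨h', C', hC'⟩ := h'
  refine ⟨h.add h', C + C', fun l => ?_⟩
  rw [add_mul]
  exact (abs_add_le _ _).trans (add_le_add (hC l) (hC' l))

theorem QuadraticGrowth.comp {q : (E →L[ℝ] ℝ) → ℝ} (h : QuadraticGrowth q) (e : E →L[ℝ] F) :
    QuadraticGrowth fun l : F →L[ℝ] ℝ => q (l ∘L e) := by
  obtain ⟨h, C, hC⟩ := h
  refine ⟨h.comp (by fun_prop), |C| * ‖e‖ ^ 2, fun l => (hC _).trans ?_⟩
  calc C * ‖l ∘L e‖ ^ 2 ≤ |C| * (‖l‖ * ‖e‖) ^ 2 := by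
        gcongr
        · exact le_abs_self C
        · exact l.opNorm_comp_le e
    _ = _ := by ring

variable [MeasurableSpace E] [MeasurableSpace F]

/-- The exponential form of the logarithmic Sobolev inequality, where `q` measures the squared
length of the differential. -/
def GradientLSI (μ : Measure E) (q : (E →L[ℝ] ℝ) → ℝ) (c : ℝ) : Prop :=
  ∀ G : E → ℝ, ContDiff ℝ 1 G → (∃ M : ℝ, ∀ x, |G x| ≤ M) →
    (∃ M : ℝ, ∀ x, ‖fderiv ℝ G x‖ ≤ M) →
      expEntropy μ G ≤ c / 2 * ∫ x, q (fderiv ℝ G x) * Real.exp (G x) ∂μ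

variable [BorelSpace E] [BorelSpace F]

theorem GradientLSI.map {μ : Measure E} {q : (E →L[ℝ] ℝ) → ℝ} {c : ℝ} (h : GradientLSI μ q c)
    (e : E ≃L[ℝ] F) :
    GradientLSI (μ.map e) (fun l => q (l ∘L (e : E →L[ℝ] F))) c := by
  rintro G hG ⟨M, hM⟩ ⟨M', hM'⟩
  have hemb : MeasurableEmbedding e := e.toHomeomorph.measurableEmbedding
  have hd : ∀ x, fderiv ℝ (G ∘ e) x = fderiv ℝ G (e x) ∘L (e : E →L[ℝ] F) := fun x =>
    ContinuousLinearEquiv.comp_right_fderiv e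
  have h1 := h (G ∘ e) (hG.comp e.contDiff) ⟨M, fun x => hM _⟩
    ⟨M' * ‖(e : E →L[ℝ] F)‖, fun x => by
      rw [hd]
      exact (ContinuousLinearMap.opNorm_comp_le _ _).trans
        (mul_le_mul_of_nonneg_right (hM' _) (norm_nonneg _))⟩
  simp only [expEntropy, hemb.integral_map] at h1 ⊢
  simpa only [hd, Function.comp_apply] using h1

variable [SecondCountableTopologyEither E F]

/-- Tensorization of the logarithmic Sobolev inequality. -/
theorem GradientLSI.prod [CompleteSpace E] [CompleteSpace F]
    {μ : Measure E} {ν : Measure F} [IsProbabilityMeasure μ]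
    [IsProbabilityMeasure ν] {q : (E →L[ℝ] ℝ) → ℝ} {q' : (F →L[ℝ] ℝ) → ℝ} {c : ℝ}
    (hq : QuadraticGrowth q) (hq' : QuadraticGrowth q') (hμ : GradientLSI μ q c)
    (hν : GradientLSI ν q' c) :
    GradientLSI (μ.prod ν) (fun l => q (l ∘L ContinuousLinearMap.inl ℝ E F) +
      q' (l ∘L ContinuousLinearMap.inr ℝ E F)) c := by
  rintro G hG ⟨M, hM⟩ ⟨M', hM'⟩
  have hGd : Differentiable ℝ G := hG.differentiable one_ne_zero
  have hfc : Continuous (fderiv ℝ G) := hG.continuous_fderiv one_ne_zero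
  have hGc := hG.continuous
  have hdx : ∀ x y, fderiv ℝ (fun x => G (x, y)) x =
      fderiv ℝ G (x, y) ∘L ContinuousLinearMap.inl ℝ E F := fun x y =>
    ((hGd (x, y)).hasFDerivAt.comp x (hasFDerivAt_prodMk_left x y)).fderiv
  have hdy : ∀ x y, fderiv ℝ (fun y => G (x, y)) y =
      fderiv ℝ G (x, y) ∘L ContinuousLinearMap.inr ℝ E F := fun x y =>
    ((hGd (x, y)).hasFDerivAt.comp y (hasFDerivAt_prodMk_right x y)).fderiv
  have hint : ∀ {r : (E × F →L[ℝ] ℝ) → ℝ}, QuadraticGrowth r →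
      Integrable (fun z => r (fderiv ℝ G z) * Real.exp (G z)) (μ.prod ν) := by
    rintro r ⟨hr, C, hC⟩
    refine integrable_of_abs_le (M := Real.exp M * (|C| * M' ^ 2))
      ((hr.comp hfc).mul (Real.continuous_exp.comp hGc)).measurable fun z => ?_
    rw [mul_comm]
    refine abs_exp_mul_le (hM z) ((hC _).trans ?_)
    gcongr
    · exact le_abs_self C
    · exact hM' z
  have j1 := hint (hq.comp (ContinuousLinearMap.inl ℝ E F))
  have j2 := hint (hq'.comp (ContinuousLinearMap.inr ℝ E F))
  obtain ⟨i1, i2, hle⟩ := expEntropy_prod_le (μ := μ) (ν := ν) hGc.measurable hM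
  refine hle.trans ?_
  simp only [add_mul]
  rw [integral_add j1 j2, mul_add, integral_prod_symm _ j1, integral_prod _ j2,
    ← integral_const_mul, ← integral_const_mul]
  refine add_le_add (integral_mono i1 (j1.integral_prod_right.const_mul _) fun y => ?_)
    (integral_mono i2 (j2.integral_prod_left.const_mul _) fun x => ?_)
  · have := hμ (fun x => G (x, y)) (hG.comp (by fun_prop)) ⟨M, fun x => hM _⟩
      ⟨M' * ‖ContinuousLinearMap.inl ℝ E F‖, fun x => by
        rw [hdx]
        exact (ContinuousLinearMap.opNorm_comp_le _ _).trans
          (mul_le_mul_of_nonneg_right (hM' _) (norm_nonneg _))⟩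
    simpa only [hdx] using this
  · have := hν (fun y => G (x, y)) (hG.comp (by fun_prop)) ⟨M, fun y => hM _⟩
      ⟨M' * ‖ContinuousLinearMap.inr ℝ E F‖, fun y => by
        rw [hdy]
        exact (ContinuousLinearMap.opNorm_comp_le _ _).trans
          (mul_le_mul_of_nonneg_right (hM' _) (norm_nonneg _))⟩
    simpa only [hdy] using this

end GradientLSI

/-- The logarithmic Sobolev inequality on the line in exponential form. -/
theorem LogSobolev.gradientLSI {ν : Measure ℝ} [IsProbabilityMeasure ν] {c : ℝ}
    (h : LogSobolev ν c) : GradientLSI ν (fun l => l 1 ^ 2) c := by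
  rintro G hG ⟨M, hM⟩ ⟨M', hM'⟩
  have hGd : Differentiable ℝ G := hG.differentiable one_ne_zero
  have hd : ∀ x, deriv (fun x => Real.exp (G x / 2)) x = Real.exp (G x / 2) * (deriv G x / 2) :=
    fun x => ((hGd x).hasDerivAt.div_const 2).exp.deriv
  have hexp : ∀ x, Real.exp (G x / 2) ≤ Real.exp (M / 2) := fun x =>
    Real.exp_le_exp.2 (by linarith [le_of_abs_le (hM x)])
  have hdb : ∀ x, |deriv G x| ≤ M' := fun x => by
    have := (fderiv ℝ G x).le_opNorm 1
    simp only [fderiv_apply_one_eq_deriv, Real.norm_eq_abs, norm_one, mul_one] at this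
    exact this.trans (hM' x)
  -- The test function `g = exp (G/2)` has `g² = exp G` and `|g'|² = |G'|² exp G / 4`, so `2 c`
  -- becomes `c / 2`.
  have h1 := h (fun x => Real.exp (G x / 2)) (by fun_prop)
    ⟨Real.exp (M / 2), fun x => by rw [Real.abs_exp]; exact hexp x⟩
    ⟨Real.exp (M / 2) * (M' / 2), fun x => by
      rw [hd, abs_mul, Real.abs_exp, abs_div, abs_two]
      exact mul_le_mul (hexp x) (by linarith [hdb x]) (by positivity) (Real.exp_pos _).le⟩
  have hsq : ∀ x, Real.exp (G x / 2) ^ 2 = Real.exp (G x) := fun x => by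
    rw [sq, ← Real.exp_add, add_halves]
  have hi : Integrable (fun y => Real.exp (G y)) ν :=
    integrable_exp_of_abs_le hG.continuous.measurable hM
  simp only [hsq, hd, mul_pow, fderiv_apply_one_eq_deriv] at h1 ⊢
  refine (le_of_eq ?_).trans (h1.trans (le_of_eq ?_))
  · rw [expEntropy]
    congr 1 with x
    rw [Real.log_div (Real.exp_pos _).ne' (integral_exp_pos hi).ne', Real.log_exp]
  · rw [← integral_const_mul, ← integral_const_mul]
    congr 1 with x
    ring

/-- The squared Euclidean length of a real linear form on `ℂⁿ`. -/
noncomputable def dualSq (n : ℕ) (l : (Fin n → ℂ) →L[ℝ] ℝ) : ℝ :=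
  ∑ i, (l (Pi.single i 1) ^ 2 + l (Pi.single i Complex.I) ^ 2)

theorem QuadraticGrowth.dualSq (n : ℕ) : QuadraticGrowth (dualSq n) := by
  unfold MatrixConcentration.dualSq
  induction (Finset.univ : Finset (Fin n)) using Finset.induction_on with
  | empty => exact ⟨by simpa using continuous_const, 0, by simp⟩
  | insert a s ha ih =>
    simp only [Finset.sum_insert ha]
    exact ((quadraticGrowth_apply_sq _).add (quadraticGrowth_apply_sq _)).add ih

theorem isProbabilityMeasure_entryLaw {μ ν : Measure ℝ} [IsProbabilityMeasure μ]
    [IsProbabilityMeasure ν] : IsProbabilityMeasure (entryLaw μ ν) :=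
  Measure.isProbabilityMeasure_map (by fun_prop)

/-- Real and imaginary parts are independent coordinates of `ℂ ≃ ℝ × ℝ`, and `l 1`, `l I` are the
two partial derivatives. -/
theorem LogSobolev.entryLaw {μ ν : Measure ℝ} [IsProbabilityMeasure μ] [IsProbabilityMeasure ν]
    {c : ℝ} (hμ : LogSobolev μ c) (hν : LogSobolev ν c) :
    GradientLSI (entryLaw μ ν) (fun l => l 1 ^ 2 + l Complex.I ^ 2) c := by
  have h := (GradientLSI.prod (quadraticGrowth_apply_sq 1) (quadraticGrowth_apply_sq 1)
    hμ.gradientLSI hν.gradientLSI).map Complex.equivRealProdCLM.symm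
  convert! h using 1
  · rw [MatrixConcentration.entryLaw]
    congr 1
    funext x
    apply Complex.ext <;> simp

theorem gradientLSI_pi {n : ℕ} (μ : Fin n → Measure ℂ) [∀ i, IsProbabilityMeasure (μ i)] {c : ℝ}
    (h : ∀ i, GradientLSI (μ i) (fun l => l 1 ^ 2 + l Complex.I ^ 2) c) :
    GradientLSI (Measure.pi μ) (dualSq n) c := by
  induction n with
  | zero =>
    rintro G - - -
    rw [Measure.pi_of_empty μ 0]
    simp [expEntropy, dualSq]
  | succ n ih =>
    have h1 := (GradientLSI.prod
      ((quadraticGrowth_apply_sq (1 : ℂ)).add (quadraticGrowth_apply_sq Complex.I))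
      (QuadraticGrowth.dualSq n) (h 0) (ih (fun i => μ i.succ) fun i => h _)).map
      (Fin.consEquivL ℝ fun _ : Fin (n + 1) => ℂ)
    rw [(measurePreserving_consEquivL μ).map_eq] at h1
    have hc0 : ∀ z : ℂ, Fin.consEquivL ℝ (fun _ : Fin (n + 1) => ℂ) (z, 0) = Pi.single 0 z := by
      intro z
      funext i
      refine Fin.cases ?_ (fun j => ?_) i <;> simp [Fin.consEquivL]
    have hcs : ∀ (j : Fin n) (z : ℂ), Fin.consEquivL ℝ (fun _ : Fin (n + 1) => ℂ)
        (0, Pi.single j z) = Pi.single j.succ z := by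
      intro j z
      funext i
      refine Fin.cases ?_ (fun k => ?_) i
      · simp [Fin.consEquivL]
      · by_cases hk : k = j
        · subst hk; simp [Fin.consEquivL]
        · simp [Fin.consEquivL, hk]
    convert! h1 using 1
    funext l
    simp only [dualSq, Fin.sum_univ_succ, ContinuousLinearMap.comp_apply,
      ContinuousLinearMap.inl_apply, ContinuousLinearMap.inr_apply,
      ContinuousLinearEquiv.coe_coe, hc0, hcs]

/-! ### Herbst's argument and a form of Fatou's lemma. -/

section Herbst

variable {Ω : Type*} [MeasurableSpace Ω] {μ : Measure Ω}

/-- Herbst's argument: a quadratic entropy bound along `s ↦ s F` gives a Gaussian moment bound. -/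
theorem integral_exp_le_of_expEntropy_le [IsProbabilityMeasure μ] {F : Ω → ℝ} {M C : ℝ}
    (hF : Measurable F) (hM : ∀ x, |F x| ≤ M)
    (h : ∀ s : ℝ, 0 < s →
      expEntropy μ (fun x => s * F x) ≤ C * s ^ 2 * ∫ x, Real.exp (s * F x) ∂μ) :
    ∫ x, Real.exp (F x) ∂μ ≤ Real.exp (∫ x, F x ∂μ + C) := by
  have hsF : ∀ s : ℝ, ∀ x, |s * F x| ≤ |s| * M := fun s x => by
    rw [abs_mul]
    exact mul_le_mul_of_nonneg_left (hM x) (abs_nonneg s)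
  have hexp : ∀ s : ℝ, Integrable (fun x => Real.exp (s * F x)) μ := fun s =>
    integrable_exp_of_abs_le (by fun_prop) (hsF s)
  have huniv : integrableExpSet F μ = Set.univ := Set.eq_univ_of_forall hexp
  have hmem : ∀ s, s ∈ interior (integrableExpSet F μ) := fun s => by simp [huniv]
  have hdiff : ∀ s, DifferentiableAt ℝ (cgf F μ) s := fun s =>
    (analyticAt_cgf (hmem s)).differentiableAt
  -- Since `s K' - K` is the entropy divided by the Laplace transform, with `K` the cumulant
  -- function, the entropy bound says `u' ≤ 0`. As `u` tends to the mean at `0`, its value at `1` is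
  -- at most the mean.
  set u : ℝ → ℝ := fun s => cgf F μ s / s - C * s with hu
  have hder : ∀ s : ℝ, 0 < s →
      HasDerivAt u ((deriv (cgf F μ) s * s - cgf F μ s * 1) / s ^ 2 - C * 1) s := fun s hs =>
    ((hdiff s).hasDerivAt.div (hasDerivAt_id s) hs.ne').sub ((hasDerivAt_id s).const_mul C)
  have hanti : AntitoneOn u (Set.Ioi 0) := by
    refine antitoneOn_of_deriv_nonpos (convex_Ioi 0)
      (fun s hs => (hder s hs).continuousAt.continuousWithinAt)
      (fun s hs => (hder s (by simpa using hs)).differentiableAt.differentiableWithinAt)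
      fun s hs => ?_
    have hs0 : 0 < s := by simpa using hs
    rw [(hder s hs0).deriv, mul_one, mul_one, sub_nonpos, div_le_iff₀ (by positivity)]
    have hmpos : 0 < mgf F μ s := mgf_pos (hexp s)
    have hent : expEntropy μ (fun x => s * F x) =
        s * (∫ x, F x * Real.exp (s * F x) ∂μ) - cgf F μ s * mgf F μ s := by
      rw [expEntropy, ← integral_const_mul]
      have i1 : Integrable (fun x => s * (F x * Real.exp (s * F x))) μ :=
        (integrable_of_abs_le (M := Real.exp (|s| * M) * M) (by fun_prop) fun x => by
          rw [mul_comm]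
          exact abs_exp_mul_le (hsF s x) (hM x)).const_mul s
      rw [mgf, ← integral_const_mul, ← integral_sub i1 ((hexp s).const_mul _)]
      congr 1 with x
      rw [cgf, mgf]
      ring
    have h1 := h s hs0
    rw [hent] at h1
    rw [deriv_cgf (hmem s)]
    have h2 : (∫ x, F x * Real.exp (s * F x) ∂μ) / mgf F μ s * s - cgf F μ s =
        (s * (∫ x, F x * Real.exp (s * F x) ∂μ) - cgf F μ s * mgf F μ s) / mgf F μ s := by
      rw [sub_div, mul_div_cancel_right₀ _ hmpos.ne']
      ring
    rw [h2, div_le_iff₀ hmpos]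
    exact h1
  have hlim : Filter.Tendsto u (nhdsWithin 0 (Set.Ioi 0)) (nhds (∫ x, F x ∂μ)) := by
    have hd0 : HasDerivAt (cgf F μ) (∫ x, F x ∂μ) 0 := by
      have := (hdiff 0).hasDerivAt
      rw [deriv_cgf_zero (hmem 0)] at this
      simpa using this
    have h1 := (hasDerivAt_iff_tendsto_slope.1 hd0).mono_left
      (nhdsWithin_mono 0 (fun s (hs : 0 < s) => hs.ne') : nhdsWithin (0 : ℝ) (Set.Ioi 0) ≤ _)
    have h2 : Filter.Tendsto (fun s : ℝ => C * s) (nhdsWithin 0 (Set.Ioi 0)) (nhds 0) := by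
      have : Filter.Tendsto (fun s : ℝ => C * s) (nhds 0) (nhds (C * 0)) :=
        (continuous_const.mul continuous_id).tendsto 0
      rw [mul_zero] at this
      exact this.mono_left nhdsWithin_le_nhds
    have h3 := h1.sub h2
    rw [sub_zero] at h3
    refine h3.congr fun s => ?_
    simp [hu, slope_def_field]
  have hle : u 1 ≤ ∫ x, F x ∂μ := by
    refine ge_of_tendsto hlim ?_
    filter_upwards [Ioo_mem_nhdsGT (zero_lt_one (α := ℝ))] with s hs
    exact hanti hs.1 (Set.mem_Ioi.2 one_pos) hs.2.le
  simp only [hu, div_one, mul_one] at hle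
  have h1 : cgf F μ 1 ≤ ∫ x, F x ∂μ + C := by linarith
  rw [cgf, Real.log_le_iff_le_exp (mgf_pos (hexp 1)), mgf] at h1
  simpa using h1

/-- Fatou's lemma for nonnegative real functions with bounded integrals. -/
theorem integrable_and_integral_le_of_tendsto {h : ℕ → Ω → ℝ} {g : Ω → ℝ} {B : ℝ}
    (hm : ∀ k, Measurable (h k)) (h0 : ∀ k x, 0 ≤ h k x) (hi : ∀ k, Integrable (h k) μ)
    (hB : ∀ k, ∫ x, h k x ∂μ ≤ B)
    (hlim : ∀ x, Filter.Tendsto (fun k => h k x) Filter.atTop (nhds (g x))) :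
    Integrable g μ ∧ ∫ x, g x ∂μ ≤ B := by
  have hg0 : ∀ x, 0 ≤ g x := fun x => ge_of_tendsto' (hlim x) fun k => h0 k x
  have hgm : Measurable g := measurable_of_tendsto_metrizable hm (tendsto_pi_nhds.2 hlim)
  have hB0 : 0 ≤ B := (integral_nonneg (h0 0)).trans (hB 0)
  have hle : ∫⁻ x, ENNReal.ofReal (g x) ∂μ ≤ ENNReal.ofReal B := by
    calc ∫⁻ x, ENNReal.ofReal (g x) ∂μ
        = ∫⁻ x, Filter.liminf (fun k => ENNReal.ofReal (h k x)) Filter.atTop ∂μ := by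
          congr 1 with x
          exact ((ENNReal.continuous_ofReal.tendsto _).comp (hlim x)).liminf_eq.symm
      _ ≤ Filter.liminf (fun k => ∫⁻ x, ENNReal.ofReal (h k x) ∂μ) Filter.atTop :=
          lintegral_liminf_le fun k => (hm k).ennreal_ofReal
      _ ≤ ENNReal.ofReal B := by
          refine (Filter.liminf_le_liminf (v := fun _ => ENNReal.ofReal B)
            (Filter.Eventually.of_forall fun k => ?_)).trans (by simp)
          rw [← ofReal_integral_eq_lintegral_ofReal (hi k) (ae_of_all _ (h0 k))]
          exact ENNReal.ofReal_le_ofReal (hB k)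
  refine ⟨⟨hgm.aestronglyMeasurable, ?_⟩, ?_⟩
  · rw [hasFiniteIntegral_iff_ofReal (ae_of_all _ hg0)]
    exact hle.trans_lt ENNReal.ofReal_lt_top
  · rw [integral_eq_lintegral_of_nonneg_ae (ae_of_all _ hg0) hgm.aestronglyMeasurable]
    exact ENNReal.toReal_le_of_le_ofReal hB0 hle

end Herbst

/-! ### Gradient bound and smoothing with the same Lipschitz constant. -/

section Mollification

variable {n : ℕ} {F : (Fin n → ℂ) → ℝ} {Λ : ℝ}

/-- The differential of a Euclidean-Lipschitz function has Euclidean length at most its constant. -/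
theorem EuclideanLipschitz.dualSq_fderiv_le (hΛ : 0 ≤ Λ) (hF : EuclideanLipschitz Λ F)
    {x : Fin n → ℂ} (hd : DifferentiableAt ℝ F x) : dualSq n (fderiv ℝ F x) ≤ Λ ^ 2 := by
  set l := fderiv ℝ F x with hl
  set Q := dualSq n l with hQ
  have hQ0 : 0 ≤ Q := Finset.sum_nonneg fun i _ => by positivity
  have hdir : ∀ v : Fin n → ℂ, |l v| ≤ Λ * √(∑ i, ‖v i‖ ^ 2) := by
    intro v
    set R := Λ * √(∑ i, ‖v i‖ ^ 2) with hR
    have hR0 : 0 ≤ R := by positivity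
    have hlip : LipschitzWith (Real.toNNReal R) fun t : ℝ => F (x + t • v) := by
      refine LipschitzWith.of_dist_le_mul fun s t => ?_
      rw [Real.dist_eq, Real.dist_eq, Real.coe_toNNReal _ hR0]
      refine (hF _ _).trans (le_of_eq ?_)
      have : ∀ i, ‖(x + s • v) i - (x + t • v) i‖ ^ 2 = (s - t) ^ 2 * ‖v i‖ ^ 2 := by
        intro i
        have : (x + s • v) i - (x + t • v) i = (s - t) • v i := by
          simp only [Pi.add_apply, Pi.smul_apply]; module
        rw [this, norm_smul, mul_pow, Real.norm_eq_abs, sq_abs]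
      simp_rw [this]
      rw [← Finset.mul_sum, Real.sqrt_mul (sq_nonneg _), Real.sqrt_sq_eq_abs, hR]
      ring
    have h1 := norm_deriv_le_of_lipschitz (x₀ := 0) hlip
    have h2 : deriv (fun t : ℝ => F (x + t • v)) 0 = l v :=
      (hd.hasFDerivAt.hasLineDerivAt v).lineDeriv
    rwa [h2, Real.norm_eq_abs, Real.coe_toNNReal _ hR0] at h1
  -- The gradient itself as direction: `l v = Q` and `v` has Euclidean length `√Q`, whence `Q ≤ Λ
  -- √Q`.
  set v : Fin n → ℂ := fun i =>
    (l (Pi.single i 1) : ℂ) + (l (Pi.single i Complex.I) : ℂ) * Complex.I with hv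
  have hvn : ∀ i, ‖v i‖ ^ 2 = l (Pi.single i 1) ^ 2 + l (Pi.single i Complex.I) ^ 2 := by
    intro i
    rw [Complex.sq_norm, Complex.normSq_add_mul_I]
  have hlv : l v = Q := by
    have h1 : v = ∑ i, (l (Pi.single i 1) • (Pi.single i 1 : Fin n → ℂ) +
        l (Pi.single i Complex.I) • (Pi.single i Complex.I : Fin n → ℂ)) := by
      conv_lhs => rw [← Finset.univ_sum_single v]
      refine Finset.sum_congr rfl fun i _ => ?_
      rw [← Pi.single_smul, ← Pi.single_smul, ← Pi.single_add]
      simp [hv]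
    rw [h1, map_sum]
    simp only [map_add, map_smul, smul_eq_mul, hQ, dualSq, sq]
  have h2 := hdir v
  simp_rw [hvn] at h2
  rw [hlv, abs_of_nonneg hQ0] at h2
  change Q ≤ Λ * √Q at h2
  have h3 : √Q * √Q ≤ Λ * √Q := by rwa [Real.mul_self_sqrt hQ0]
  rcases (Real.sqrt_nonneg Q).eq_or_lt with h4 | h4
  · rw [← Real.mul_self_sqrt hQ0, ← h4]
    nlinarith
  · have h5 := le_of_mul_le_mul_right h3 h4
    rw [← Real.sq_sqrt hQ0]
    exact pow_le_pow_left₀ h4.le h5 2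

/-- Euclidean-Lipschitz functions are uniform limits of smooth ones with the same constant. -/
theorem EuclideanLipschitz.exists_contDiff (hΛ : 0 ≤ Λ) (hF : EuclideanLipschitz Λ F) {ε : ℝ}
    (hε : 0 < ε) : ∃ G : (Fin n → ℂ) → ℝ, ContDiff ℝ 1 G ∧ EuclideanLipschitz Λ G ∧
      ∀ x, |G x - F x| ≤ ε := by
  have hL := hF.lipschitzWith hΛ
  set L : NNReal := Real.toNNReal (Λ * √n) with hLdef
  have hr : 0 < ε / (L + 1) := by positivity
  let φ : ContDiffBump (0 : Fin n → ℂ) :=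
    ⟨ε / (L + 1) / 2, ε / (L + 1), half_pos hr, half_lt_self hr⟩
  refine ⟨convolution (φ.normed volume) F (ContinuousLinearMap.lsmul ℝ ℝ) volume,
    φ.hasCompactSupport_normed.contDiff_convolution_left _ φ.contDiff_normed
      hL.continuous.locallyIntegrable, fun x y => ?_, fun x => ?_⟩
  · have hi : ∀ z, Integrable (fun t => φ.normed volume t * F (z - t)) volume := fun z =>
      (φ.continuous_normed.mul (hL.continuous.comp (by fun_prop))).integrable_of_hasCompactSupport
        φ.hasCompactSupport_normed.mul_right
    simp only [convolution_def, ContinuousLinearMap.lsmul_apply, smul_eq_mul]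
    rw [← integral_sub (hi x) (hi y), ← Real.norm_eq_abs]
    -- An average of translates against a kernel of mass one keeps the Euclidean constant.
    calc ‖∫ t, (φ.normed volume t * F (x - t) - φ.normed volume t * F (y - t))‖
        ≤ ∫ t, φ.normed volume t * (Λ * √(∑ i, ‖x i - y i‖ ^ 2)) := by
          refine norm_integral_le_of_norm_le (φ.integrable_normed.mul_const _)
            (ae_of_all _ fun t => ?_)
          rw [← mul_sub, norm_mul, Real.norm_of_nonneg (φ.nonneg_normed t)]
          refine mul_le_mul_of_nonneg_left ?_ (φ.nonneg_normed t)
          simpa using hF (x - t) (y - t)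
      _ = _ := by rw [integral_mul_const, φ.integral_normed, one_mul]
  · rw [← Real.dist_eq]
    refine φ.dist_normed_convolution_le hL.continuous.aestronglyMeasurable fun z hz => ?_
    refine (hL.dist_le_mul z x).trans ?_
    have hz' : dist z x ≤ ε / (L + 1) := (Metric.mem_ball.1 hz).le
    calc (L : ℝ) * dist z x ≤ (L + 1) * (ε / (L + 1)) := by
          gcongr
          linarith
      _ = ε := by field_simp

end Mollification

/-! ### From the logarithmic Sobolev inequality to sub-Gaussian bounds. -/

section LogSobolevConcentration

variable {n : ℕ} {ν : Measure (Fin n → ℂ)} [IsProbabilityMeasure ν] {c : ℝ}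
  {F : (Fin n → ℂ) → ℝ} {Λ : ℝ}

theorem GradientLSI.integral_exp_le_of_contDiff (hν : GradientLSI ν (dualSq n) c) (hc : 0 ≤ c)
    (hΛ : 0 ≤ Λ) (hF : EuclideanLipschitz Λ F) (hd : ContDiff ℝ 1 F) {M : ℝ}
    (hM : ∀ x, |F x| ≤ M) :
    ∫ x, Real.exp (F x) ∂ν ≤ Real.exp (∫ x, F x ∂ν + c / 2 * Λ ^ 2) := by
  refine integral_exp_le_of_expEntropy_le hd.continuous.measurable hM fun s hs => ?_
  have hsF := hF.const_mul s
  have hsΛ : 0 ≤ |s| * Λ := by positivity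
  have hsd : ContDiff ℝ 1 fun x => s * F x := contDiff_const.mul hd
  have hsM : ∀ x, |s * F x| ≤ |s| * M := fun x => by
    rw [abs_mul]
    exact mul_le_mul_of_nonneg_left (hM x) (abs_nonneg s)
  have hei : Integrable (fun x => Real.exp (s * F x)) ν :=
    integrable_exp_of_abs_le hsd.continuous.measurable hsM
  refine (hν _ hsd ⟨_, hsM⟩ ⟨_, fun x => norm_fderiv_le_of_lipschitz ℝ
    (hsF.lipschitzWith hsΛ)⟩).trans ?_
  have hle : ∀ x, dualSq n (fderiv ℝ (fun x => s * F x) x) * Real.exp (s * F x) ≤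
      (s ^ 2 * Λ ^ 2) * Real.exp (s * F x) := fun x => by
    have := hsF.dualSq_fderiv_le hsΛ ((hsd.differentiable one_ne_zero) x)
    rw [mul_pow, sq_abs] at this
    exact mul_le_mul_of_nonneg_right this (Real.exp_pos _).le
  calc c / 2 * ∫ x, dualSq n (fderiv ℝ (fun x => s * F x) x) * Real.exp (s * F x) ∂ν
      ≤ c / 2 * ∫ x, (s ^ 2 * Λ ^ 2) * Real.exp (s * F x) ∂ν := by
        refine mul_le_mul_of_nonneg_left (integral_mono_of_nonneg (ae_of_all _ fun x => ?_)
          (hei.const_mul _) (ae_of_all _ hle)) (by positivity)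
        exact mul_nonneg (Finset.sum_nonneg fun i _ => by positivity) (Real.exp_pos _).le
    _ = _ := by rw [integral_const_mul]; ring

/-- A smooth approximation within `ε / 2` costs `ε / 2` in the Laplace transform and `ε / 2` in the
mean. -/
theorem GradientLSI.integral_exp_le_of_bounded (hν : GradientLSI ν (dualSq n) c) (hc : 0 ≤ c)
    (hΛ : 0 ≤ Λ) (hF : EuclideanLipschitz Λ F) {M : ℝ} (hM : ∀ x, |F x| ≤ M) :
    ∫ x, Real.exp (F x) ∂ν ≤ Real.exp (∫ x, F x ∂ν + c / 2 * Λ ^ 2) := by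
  have hFm : Measurable F := (hF.lipschitzWith hΛ).continuous.measurable
  have hFi : Integrable F ν := integrable_of_abs_le hFm hM
  have hFe : Integrable (fun x => Real.exp (F x)) ν := integrable_exp_of_abs_le hFm hM
  rw [← Real.log_le_iff_le_exp (integral_exp_pos hFe)]
  refine le_of_forall_pos_le_add fun ε hε => ?_
  obtain ⟨G, hGd, hGL, hGF⟩ := hF.exists_contDiff hΛ (half_pos hε)
  have hGM : ∀ x, |G x| ≤ ε / 2 + M := fun x => by
    calc |G x| = |(G x - F x) + F x| := by ring_nf
      _ ≤ _ := (abs_add_le _ _).trans (add_le_add (hGF x) (hM x))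
  have hGm := hGd.continuous.measurable
  have hGi : Integrable G ν := integrable_of_abs_le hGm hGM
  have hGe : Integrable (fun x => Real.exp (G x)) ν := integrable_exp_of_abs_le hGm hGM
  have h1 := hν.integral_exp_le_of_contDiff hc hΛ hGL hGd hGM
  have h2 : ∫ x, G x ∂ν ≤ ∫ x, F x ∂ν + ε / 2 := by
    calc ∫ x, G x ∂ν ≤ ∫ x, (F x + ε / 2) ∂ν :=
          integral_mono hGi (hFi.add (integrable_const _)) fun x => by
            linarith [le_of_abs_le (hGF x)]
      _ = _ := by rw [integral_add hFi (integrable_const _)]; simp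
  rw [Real.log_le_iff_le_exp (integral_exp_pos hFe)]
  calc ∫ x, Real.exp (F x) ∂ν ≤ ∫ x, Real.exp (ε / 2) * Real.exp (G x) ∂ν :=
        integral_mono hFe (hGe.const_mul _) fun x => by
          rw [← Real.exp_add]
          exact Real.exp_le_exp.2 (by linarith [neg_le_of_abs_le (hGF x)])
    _ = Real.exp (ε / 2) * ∫ x, Real.exp (G x) ∂ν := integral_const_mul _ _
    _ ≤ Real.exp (ε / 2) * Real.exp (∫ x, G x ∂ν + c / 2 * Λ ^ 2) := by gcongr
    _ ≤ _ := by
        rw [← Real.exp_add]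
        exact Real.exp_le_exp.2 (by linarith)

theorem EuclideanLipschitz.abs (hF : EuclideanLipschitz Λ F) :
    EuclideanLipschitz Λ fun x => |F x| := fun x y =>
  (abs_abs_sub_abs_le_abs_sub _ _).trans (hF x y)

theorem EuclideanLipschitz.min_const (hF : EuclideanLipschitz Λ F) (k : ℝ) :
    EuclideanLipschitz Λ fun x => min (F x) k := fun x y => by
  refine (abs_min_sub_min_le_max _ _ _ _).trans ?_
  simpa using hF x y

theorem EuclideanLipschitz.max_const (hF : EuclideanLipschitz Λ F) (k : ℝ) :
    EuclideanLipschitz Λ fun x => max (F x) k := fun x y => by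
  refine (abs_max_sub_max_le_max _ _ _ _).trans ?_
  simpa using hF x y

/-- Lipschitz functions are integrable under a logarithmic Sobolev inequality. -/
theorem GradientLSI.integrable (hν : GradientLSI ν (dualSq n) c) (hc : 0 ≤ c)
    (hΛ : 0 ≤ Λ) (hF : EuclideanLipschitz Λ F) : Integrable F ν := by
  have hFm : Measurable F := (hF.lipschitzWith hΛ).continuous.measurable
  have hGM : ∀ (k : ℕ) x, abs (min |F x| (k : ℝ)) ≤ k := fun k x => by
    rw [abs_of_nonneg (le_min (abs_nonneg _) (Nat.cast_nonneg k))]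
    exact min_le_right _ _
  have hGm : ∀ k : ℕ, Measurable fun x => min |F x| (k : ℝ) := fun k => by
    have := hFm.abs
    fun_prop
  have hGi : ∀ k : ℕ, Integrable (fun x => min |F x| (k : ℝ)) ν := fun k =>
    integrable_of_abs_le (hGm k) (hGM k)
  have hbase : Integrable (fun x => Real.exp (-|F x|)) ν :=
    integrable_of_abs_le (M := 1) (by have := hFm.abs; fun_prop) fun x => by
      rw [Real.abs_exp]
      exact Real.exp_le_one_iff.2 (neg_nonpos.2 (abs_nonneg _))
  set p := ∫ x, Real.exp (-|F x|) ∂ν with hp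
  have hp0 : 0 < p := integral_exp_pos hbase
  -- The Laplace bound is applied to minus the truncation: its exponential integral is at least `p >
  -- 0`, so the truncated means stay bounded uniformly in `k`.
  have hbound : ∀ k : ℕ, ∫ x, min |F x| (k : ℝ) ∂ν ≤ c / 2 * Λ ^ 2 - Real.log p := by
    intro k
    have hneg : ∀ x, abs (-1 * min |F x| (k : ℝ)) ≤ k := fun x => by
      simpa using hGM k x
    have h1 := hν.integral_exp_le_of_bounded hc (Λ := |-1| * Λ) (by positivity)
      ((hF.abs.min_const k).const_mul (-1)) hneg
    rw [integral_const_mul] at h1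
    have h2 : p ≤ ∫ x, Real.exp (-1 * min |F x| (k : ℝ)) ∂ν := by
      refine integral_mono hbase (integrable_exp_of_abs_le ((hGm k).const_mul _) hneg) fun x => ?_
      exact Real.exp_le_exp.2 (by linarith [min_le_left |F x| (k : ℝ)])
    have h3 := (Real.log_le_iff_le_exp hp0).2 (h2.trans h1)
    simp only [abs_neg, abs_one, one_mul] at h3
    linarith
  have h := (integrable_and_integral_le_of_tendsto hGm
    (fun k x => le_min (abs_nonneg _) (Nat.cast_nonneg k)) hGi hbound (g := fun x => |F x|)
    fun x => by
      refine tendsto_const_nhds.congr' ?_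
      obtain ⟨k₀, hk₀⟩ := exists_nat_ge |F x|
      filter_upwards [Filter.eventually_ge_atTop k₀] with k hk
      exact (min_eq_left (hk₀.trans (by exact_mod_cast hk))).symm).1
  exact (integrable_norm_iff hFm.aestronglyMeasurable).1 h

/-- Truncate at `±k`: the means converge by domination by `|F|`, and Fatou's lemma passes the
exponential bound to the limit. -/
theorem GradientLSI.integral_exp_le (hν : GradientLSI ν (dualSq n) c) (hc : 0 ≤ c)
    (hΛ : 0 ≤ Λ) (hF : EuclideanLipschitz Λ F) :
    Integrable (fun x => Real.exp (F x - ∫ y, F y ∂ν)) ν ∧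
      ∫ x, Real.exp (F x - ∫ y, F y ∂ν) ∂ν ≤ Real.exp (c / 2 * Λ ^ 2) := by
  have hFm : Measurable F := (hF.lipschitzWith hΛ).continuous.measurable
  have hFi := hν.integrable hc hΛ hF
  set G : ℕ → (Fin n → ℂ) → ℝ := fun k x => max (min (F x) k) (-k) with hG
  have hGm : ∀ k, Measurable (G k) := fun k => by fun_prop
  have hGM : ∀ k x, |G k x| ≤ k := fun k x => by
    rw [abs_le]
    exact ⟨le_max_right _ _, max_le (min_le_right _ _) (by linarith [Nat.cast_nonneg (α := ℝ) k])⟩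
  have hGF : ∀ k x, |G k x| ≤ |F x| := fun k x => by
    have hk := Nat.cast_nonneg (α := ℝ) k
    rw [abs_le]
    constructor
    · refine le_max_of_le_left (le_min (neg_abs_le _) ?_)
      linarith [abs_nonneg (F x)]
    · refine max_le ((min_le_left _ _).trans (le_abs_self _)) ?_
      linarith [abs_nonneg (F x)]
  have hGlim : ∀ x, Filter.Tendsto (fun k => G k x) Filter.atTop (nhds (F x)) := fun x => by
    refine tendsto_const_nhds.congr' ?_
    obtain ⟨k₀, hk₀⟩ := exists_nat_ge |F x|
    filter_upwards [Filter.eventually_ge_atTop k₀] with k hk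
    have h1 : |F x| ≤ k := hk₀.trans (by exact_mod_cast hk)
    rw [abs_le] at h1
    rw [hG]
    simp only
    rw [min_eq_left h1.2, max_eq_left h1.1]
  have hIlim : Filter.Tendsto (fun k => ∫ x, G k x ∂ν) Filter.atTop (nhds (∫ x, F x ∂ν)) :=
    tendsto_integral_of_dominated_convergence (fun x => |F x|)
      (fun k => (hGm k).aestronglyMeasurable) hFi.abs
      (fun k => ae_of_all _ (hGF k)) (ae_of_all _ hGlim)
  have hexpi : ∀ k, Integrable (fun x => Real.exp (G k x)) ν := fun k =>
    integrable_exp_of_abs_le (hGm k) (hGM k)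
  refine integrable_and_integral_le_of_tendsto
    (h := fun k x => Real.exp (G k x - ∫ y, G k y ∂ν)) (fun k => by have := hGm k; fun_prop)
    (fun k x => (Real.exp_pos _).le) (fun k => ?_) (fun k => ?_)
    (fun x => (Real.continuous_exp.tendsto _).comp ((hGlim x).sub hIlim))
  · simp_rw [Real.exp_sub]
    exact (hexpi k).div_const _
  · have h1 := hν.integral_exp_le_of_bounded hc hΛ ((hF.min_const k).max_const (-k)) (hGM k)
    simp_rw [Real.exp_sub]
    rw [integral_div, div_le_iff₀ (Real.exp_pos _), ← Real.exp_add, add_comm]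
    exact h1

/-- Lipschitz functions are sub-Gaussian under a logarithmic Sobolev inequality. -/
theorem GradientLSI.hasSubgaussianMGF (hν : GradientLSI ν (dualSq n) c) (hc : 0 ≤ c)
    (hΛ : 0 ≤ Λ) (hF : EuclideanLipschitz Λ F) :
    HasSubgaussianMGF (fun x => F x - ∫ y, F y ∂ν) (Real.toNNReal (c * Λ ^ 2)) ν := by
  have key : ∀ t : ℝ, _ := fun t =>
    hν.integral_exp_le hc (Λ := |t| * Λ) (by positivity) (hF.const_mul t)
  simp only [integral_const_mul, ← mul_sub] at key
  refine ⟨fun t => (key t).1, fun t => (key t).2.trans (le_of_eq ?_)⟩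
  rw [Real.coe_toNNReal _ (by positivity), mul_pow, sq_abs]
  ring_nf

end LogSobolevConcentration

/-! ### The Lipschitz constant as a supremum. -/

section LipConst

variable {f : ℝ → ℝ}

theorem bddAbove_lipConst {L : NNReal} (hf : LipschitzWith L f) :
    BddAbove (Set.range fun p : {p : ℝ × ℝ // p.1 ≠ p.2} =>
      |f p.1.1 - f p.1.2| / |p.1.1 - p.1.2|) := by
  refine ⟨L, ?_⟩
  rintro _ ⟨⟨⟨x, y⟩, hxy⟩, rfl⟩
  have := hf.dist_le_mul x y
  rw [Real.dist_eq, Real.dist_eq] at this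
  exact div_le_of_le_mul₀ (abs_nonneg _) L.2 this

theorem lipConst_nonneg (f : ℝ → ℝ) : 0 ≤ lipConst f := Real.iSup_nonneg fun _ => by positivity

theorem abs_sub_le_lipConst_mul {L : NNReal} (hf : LipschitzWith L f) (x y : ℝ) :
    |f x - f y| ≤ lipConst f * |x - y| := by
  rcases eq_or_ne x y with rfl | hxy
  · simp
  · rw [← div_le_iff₀ (abs_pos.2 (sub_ne_zero.2 hxy))]
    exact le_ciSup (bddAbove_lipConst hf) ⟨(x, y), hxy⟩

end LipConst

/-! ### Self-adjoint arrays parametrized by their upper triangle. -/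

section HermitianArray

variable {N : ℕ}

/-- The index set of the entries on and above the diagonal. -/
abbrev UpperIndex (N : ℕ) : Type := {p : Fin N × Fin N // p.1 ≤ p.2}

/-- The self-adjoint array with prescribed entries above the diagonal and prescribed real parts on
the diagonal. -/
noncomputable def hermitianArray (w : UpperIndex N → ℂ) (i j : Fin N) : ℂ :=
  if h : i < j then w ⟨(i, j), h.le⟩
  else if h : j < i then (starRingEnd ℂ) (w ⟨(j, i), h.le⟩)
  else ((w ⟨(i, i), le_rfl⟩).re : ℂ)

theorem hermitianArray_conj (w : UpperIndex N → ℂ) (i j : Fin N) :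
    hermitianArray w i j = (starRingEnd ℂ) (hermitianArray w j i) := by
  unfold hermitianArray
  rcases lt_trichotomy i j with h | rfl | h
  · simp [h, h.not_gt]
  · simp
  · simp [h, h.not_gt]

theorem hermitianArray_eq {v : Fin N → Fin N → ℂ} (hv : ∀ i j, v i j = (starRingEnd ℂ) (v j i)) :
    hermitianArray (fun p => v p.1.1 p.1.2) = v := by
  funext i j
  unfold hermitianArray
  rcases lt_trichotomy i j with h | rfl | h
  · simp [h]
  · simpa using Complex.conj_eq_iff_re.1 (hv i i).symm
  · simpa [h, h.not_gt] using (hv i j).symm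

theorem hermitianArray_combo (w w' : UpperIndex N → ℂ) (s t : ℝ) (i j : Fin N) :
    hermitianArray (s • w + t • w') i j =
      s * hermitianArray w i j + t * hermitianArray w' i j := by
  unfold hermitianArray
  rcases lt_trichotomy i j with h | rfl | h
  · simp [h]
  · simp
  · simp [h, h.not_gt]

/-- Each off-diagonal coordinate occurs twice and taking real parts on the diagonal contracts; this
is the source of the `√2` in the Lipschitz constant. -/
theorem sum_norm_sq_hermitianArray_sub_le (w w' : UpperIndex N → ℂ) :
    ∑ i, ∑ j, ‖hermitianArray w i j - hermitianArray w' i j‖ ^ 2 ≤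
      2 * ∑ p, ‖w p - w' p‖ ^ 2 := by
  set g : Fin N → Fin N → ℝ := fun i j =>
    if h : i ≤ j then ‖w ⟨(i, j), h⟩ - w' ⟨(i, j), h⟩‖ ^ 2 else 0 with hg
  have hg0 : ∀ i j, 0 ≤ g i j := fun i j => by
    simp only [hg]
    split_ifs <;> positivity
  have hsum : ∑ i, ∑ j, g i j = ∑ p, ‖w p - w' p‖ ^ 2 := by
    rw [← Fintype.sum_prod_type']
    rw [← Finset.sum_filter_add_sum_filter_not Finset.univ (fun q : Fin N × Fin N => q.1 ≤ q.2)]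
    rw [Finset.sum_subtype (p := fun q : Fin N × Fin N => q.1 ≤ q.2)
      (Finset.univ.filter fun q : Fin N × Fin N => q.1 ≤ q.2) (by simp)]
    rw [Finset.sum_eq_zero (s := Finset.univ.filter fun q : Fin N × Fin N => ¬ q.1 ≤ q.2), add_zero]
    · refine Finset.sum_congr rfl fun p _ => ?_
      simp only [hg]
      rw [dif_pos p.2]
    · intro q hq
      simp only [hg]
      rw [dif_neg (by simpa using hq)]
  have hle : ∀ i j, ‖hermitianArray w i j - hermitianArray w' i j‖ ^ 2 ≤ g i j + g j i := by
    intro i j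
    rcases lt_trichotomy i j with h | rfl | h
    · refine le_add_of_le_of_nonneg (le_of_eq ?_) (hg0 _ _)
      simp [hermitianArray, hg, h, h.le]
    · refine le_add_of_le_of_nonneg ?_ (hg0 _ _)
      simp only [hermitianArray, hg, lt_irrefl, dite_false, le_refl, dite_true]
      rw [← Complex.ofReal_sub, Complex.norm_real, ← Complex.sub_re, Real.norm_eq_abs]
      exact pow_le_pow_left₀ (abs_nonneg _) (Complex.abs_re_le_norm _) 2
    · refine le_add_of_nonneg_of_le (hg0 _ _) (le_of_eq ?_)
      simp only [hermitianArray, hg, h, h.not_gt, h.le, dite_false, dite_true]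
      rw [← map_sub, RCLike.norm_conj]
  calc ∑ i, ∑ j, ‖hermitianArray w i j - hermitianArray w' i j‖ ^ 2
      ≤ ∑ i, ∑ j, (g i j + g j i) :=
        Finset.sum_le_sum fun i _ => Finset.sum_le_sum fun j _ => hle i j
    _ = ∑ i, ∑ j, g i j + ∑ i, ∑ j, g j i := by simp only [Finset.sum_add_distrib]
    _ = _ := by rw [Finset.sum_comm (f := fun i j => g j i), hsum]; ring

end HermitianArray

/-! ### Convexity and Lipschitz constant of the statistic. -/

section SpectralStat

variable {N : ℕ} {A : Matrix (Fin N) (Fin N) ℂ} {f : ℝ → ℝ}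

theorem spectralStat_eq {v : Fin N → Fin N → ℂ} (h : (weightedMatrix A v).IsHermitian) :
    spectralStat f A v = (((N : ℝ)⁻¹ * ∑ i, f (h.eigenvalues i) : ℝ) : ℂ) := by
  rw [spectralStat, normTrace, trace_cfc_eq_sum f h]
  push_cast
  rfl

theorem isHermitian_weightedMatrix_hermitianArray (hA : A.IsHermitian) (w : UpperIndex N → ℂ) :
    (weightedMatrix A (hermitianArray w)).IsHermitian :=
  weightedMatrix_isHermitian hA (hermitianArray_conj w)

/-- The spectral statistic as a function of the entries on and above the diagonal, listed by `e`. -/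
noncomputable def upperStat {n : ℕ} (f : ℝ → ℝ) (A : Matrix (Fin N) (Fin N) ℂ)
    (e : Fin n ≃ UpperIndex N) (w : Fin n → ℂ) : ℝ :=
  (spectralStat f A (hermitianArray (w ∘ e.symm))).re

variable {n : ℕ} (e : Fin n ≃ UpperIndex N)

theorem upperStat_eq (hA : A.IsHermitian) (w : Fin n → ℂ) :
    upperStat f A e w = (N : ℝ)⁻¹ *
      ∑ i, f ((isHermitian_weightedMatrix_hermitianArray hA (w ∘ e.symm)).eigenvalues i) := by
  rw [upperStat, spectralStat_eq (isHermitian_weightedMatrix_hermitianArray hA _),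
    Complex.ofReal_re]

theorem spectralStat_eq_upperStat (hA : A.IsHermitian) {v : Fin N → Fin N → ℂ}
    (hv : ∀ i j, v i j = (starRingEnd ℂ) (v j i)) :
    spectralStat f A v = (upperStat f A e fun k => v (e k).1.1 (e k).1.2 : ℂ) := by
  have h : hermitianArray ((fun k => v (e k).1.1 (e k).1.2) ∘ e.symm) = v := by
    rw [← hermitianArray_eq hv]
    congr 1
    funext p
    simp [hermitianArray_eq hv]
  rw [upperStat, h, spectralStat_eq (weightedMatrix_isHermitian hA hv), Complex.ofReal_re]

/-- The matrix depends real-linearly on the upper entries, so Klein's lemma applies. -/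
theorem convexOn_upperStat (hA : A.IsHermitian) (hf : ConvexOn ℝ Set.univ f) :
    ConvexOn ℝ Set.univ (upperStat f A e) := by
  refine ⟨convex_univ, fun w _ w' _ s t hs ht hst => ?_⟩
  have h := sum_eigenvalues_convex
    (isHermitian_weightedMatrix_hermitianArray hA (w ∘ e.symm))
    (isHermitian_weightedMatrix_hermitianArray hA (w' ∘ e.symm))
    (isHermitian_weightedMatrix_hermitianArray hA ((s • w + t • w') ∘ e.symm)) hf hs ht hst (by
      ext i j
      have : (s • w + t • w') ∘ e.symm = s • (w ∘ e.symm) + t • (w' ∘ e.symm) := rfl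
      rw [this]
      simp only [weightedMatrix, Matrix.of_apply, Matrix.add_apply, Matrix.smul_apply,
        hermitianArray_combo, smul_eq_mul]
      ring)
  rw [upperStat_eq e hA, upperStat_eq e hA, upperStat_eq e hA]
  simp only [smul_eq_mul]
  have := mul_le_mul_of_nonneg_left h (inv_nonneg.2 (Nat.cast_nonneg (α := ℝ) N))
  linarith

/-- The constant multiplies `1 / N` from the trace, `lipConst f * √N` from the spectral sum, `a /
√N` from the entries and `√2` from the symmetry. -/
theorem euclideanLipschitz_upperStat (hN : 1 ≤ N) (hA : A.IsHermitian) {a : ℝ}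
    (ha : ∀ i j, ‖A i j‖ ≤ a) {L : NNReal} (hf : LipschitzWith L f) :
    EuclideanLipschitz (√2 * a * lipConst f / N) (upperStat f A e) := by
  intro w w'
  have hN0 : (0 : ℝ) < N := by exact_mod_cast hN
  have ha0 : 0 ≤ a := (norm_nonneg _).trans (ha ⟨0, hN⟩ ⟨0, hN⟩)
  set S := ∑ k, ‖w k - w' k‖ ^ 2 with hS
  have hS' : ∑ p, ‖(w ∘ e.symm) p - (w' ∘ e.symm) p‖ ^ 2 = S :=
    Equiv.sum_comp e.symm fun k => ‖w k - w' k‖ ^ 2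
  have h1 := abs_sum_eigenvalues_sub_le
    (isHermitian_weightedMatrix_hermitianArray hA (w ∘ e.symm))
    (isHermitian_weightedMatrix_hermitianArray hA (w' ∘ e.symm)) (lipConst_nonneg f)
    (abs_sub_le_lipConst_mul hf)
  have h2 : ∑ i, ∑ j, ‖(weightedMatrix A (hermitianArray (w ∘ e.symm)) -
      weightedMatrix A (hermitianArray (w' ∘ e.symm))) i j‖ ^ 2 ≤ 2 * a ^ 2 / N * S := by
    calc _ ≤ ∑ i, ∑ j, a ^ 2 / N *
          ‖hermitianArray (w ∘ e.symm) i j - hermitianArray (w' ∘ e.symm) i j‖ ^ 2 := by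
          refine Finset.sum_le_sum fun i _ => Finset.sum_le_sum fun j _ => ?_
          simp only [weightedMatrix, Matrix.sub_apply, Matrix.of_apply]
          rw [← mul_sub, norm_mul, norm_mul, mul_pow, mul_pow, Complex.norm_real,
            Real.norm_eq_abs, sq_abs, div_pow, one_pow, Real.sq_sqrt hN0.le]
          refine mul_le_mul_of_nonneg_right ?_ (by positivity)
          rw [one_div_mul_eq_div]
          have := ha i j
          gcongr
      _ = a ^ 2 / N * ∑ i, ∑ j,
          ‖hermitianArray (w ∘ e.symm) i j - hermitianArray (w' ∘ e.symm) i j‖ ^ 2 := by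
          simp only [Finset.mul_sum]
      _ ≤ a ^ 2 / N * (2 * S) := by
          rw [← hS']
          exact mul_le_mul_of_nonneg_left (sum_norm_sq_hermitianArray_sub_le _ _) (by positivity)
      _ = _ := by ring
  rw [upperStat_eq e hA, upperStat_eq e hA, ← mul_sub, abs_mul, abs_of_nonneg (by positivity)]
  have hL0 := lipConst_nonneg f
  calc _ ≤ (N : ℝ)⁻¹ * (lipConst f * √N * √(2 * a ^ 2 / N * S)) := by
        refine mul_le_mul_of_nonneg_left (h1.trans ?_) (by positivity)
        rw [Fintype.card_fin]
        gcongr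
    _ = _ := by
        rw [Real.sqrt_mul (by positivity), Real.sqrt_div (by positivity),
          Real.sqrt_mul (by norm_num), Real.sqrt_sq ha0]
        have : √(N : ℝ) ≠ 0 := (Real.sqrt_pos.2 hN0).ne'
        field_simp

end SpectralStat

/-! ### Passage from the probability space to the law of the entries. -/

section Transfer

variable {Ω : Type*} [MeasurableSpace Ω] {P : Measure Ω}

/-- Integrability and deviation probabilities depend only on the law of the driving vector. -/
theorem integrable_and_deviation_of_map {n : ℕ} {ν : Measure (Fin n → ℂ)} {W : Ω → Fin n → ℂ}
    (hW : AEMeasurable W P) (hmap : P.map W = ν) {F : (Fin n → ℂ) → ℝ} (hF : Continuous F)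
    (hFi : Integrable F ν) {Z : Ω → ℂ} (hZ : ∀ x, Z x = (F (W x) : ℂ)) :
    Integrable Z P ∧ ∀ δ : ℝ, P.real {x | δ ≤ ‖Z x - ∫ y, Z y ∂P‖} =
      ν.real {w | δ ≤ |F w - ∫ y, F y ∂ν|} := by
  subst hmap
  obtain rfl : Z = fun x => (F (W x) : ℂ) := funext hZ
  refine ⟨((integrable_map_measure hF.aestronglyMeasurable hW).1 hFi).ofReal, fun δ => ?_⟩
  have hI : ∫ y, (F (W y) : ℂ) ∂P = ((∫ y, F y ∂(P.map W) : ℝ) : ℂ) := by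
    rw [integral_complex_ofReal, integral_map hW hF.aestronglyMeasurable]
  have hm : MeasurableSet {w | δ ≤ |F w - ∫ y, F y ∂(P.map W)|} :=
    measurableSet_le measurable_const (by have := hF.measurable; fun_prop)
  rw [hI, map_measureReal_apply_of_aemeasurable hW hm]
  congr 1
  ext x
  simp only [Set.mem_ofPred_eq, Set.mem_preimage]
  rw [← Complex.ofReal_sub, Complex.norm_real, Real.norm_eq_abs]

end Transfer

end MatrixConcentration

/-! ### Assembly of the two concentration bounds. -/

theorem theorem3p2 {Ω : Type*} [MeasurableSpace Ω] (P : Measure Ω) [IsProbabilityMeasure P]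
    (N : ℕ) (hN : 1 ≤ N)
    -- the deterministic self-adjoint matrix, with entries bounded by `a`
    (A : Matrix (Fin N) (Fin N) ℂ) (hA : A.IsHermitian)
    (a : ℝ) (ha : ∀ i j, ‖A i j‖ ≤ a)
    -- the laws of the real and of the imaginary parts of the entries
    (PR PI : Fin N → Fin N → Measure ℝ)
    (hPR : ∀ i j, i ≤ j → IsProbabilityMeasure (PR i j))
    (hPI : ∀ i j, i ≤ j → IsProbabilityMeasure (PI i j))
    -- the self-adjoint random array, with independent entries on and above the diagonal
    (ω : Fin N → Fin N → Ω → ℂ)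
    (hsa : ∀ i j x, ω i j x = (starRingEnd ℂ) (ω j i x))
    (hlaw : ∀ i j, i ≤ j →
      HasLaw (ω i j) (MatrixConcentration.entryLaw (PR i j) (PI i j)) P)
    (hind : iIndepFun (fun p : {p : Fin N × Fin N // p.1 ≤ p.2} => ω p.1.1 p.1.2) P) :
    -- uniformly compactly supported entries, convex Lipschitz test functions
    (∀ K : Set ℂ, IsCompact K →
      (∀ i j, i ≤ j → MatrixConcentration.entryLaw (PR i j) (PI i j) Kᶜ = 0) →
      ∀ f : ℝ → ℝ, ConvexOn ℝ Set.univ f → (∃ L, LipschitzWith L f) →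
        Integrable (fun x => MatrixConcentration.spectralStat f A (fun i j => ω i j x)) P ∧
        ∀ δ₀ : ℝ,
          δ₀ = 8 * Metric.diam K * Real.sqrt Real.pi * a * MatrixConcentration.lipConst f / N →
          ∀ δ : ℝ, δ₀ < δ →
            P.real {x | δ ≤ ‖MatrixConcentration.spectralStat f A (fun i j => ω i j x) -
                ∫ y, MatrixConcentration.spectralStat f A (fun i j => ω i j y) ∂P‖} ≤
              4 * Real.exp (-(1 / (16 * Metric.diam K ^ 2 * a ^ 2 *
                MatrixConcentration.lipConst f ^ 2)) * (N : ℝ) ^ 2 * (δ - δ₀) ^ 2)) ∧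
    -- entries with a uniform logarithmic Sobolev inequality, Lipschitz test functions
    (∀ c : ℝ,
      (∀ i j, i ≤ j → MatrixConcentration.LogSobolev (PR i j) c ∧
        MatrixConcentration.LogSobolev (PI i j) c) →
      ∀ f : ℝ → ℝ, (∃ L, LipschitzWith L f) →
        Integrable (fun x => MatrixConcentration.spectralStat f A (fun i j => ω i j x)) P ∧
        ∀ δ : ℝ, 0 < δ →
          P.real {x | δ ≤ ‖MatrixConcentration.spectralStat f A (fun i j => ω i j x) -
              ∫ y, MatrixConcentration.spectralStat f A (fun i j => ω i j y) ∂P‖} ≤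
            2 * Real.exp (-(1 / (8 * c * a ^ 2 *
              MatrixConcentration.lipConst f ^ 2)) * (N : ℝ) ^ 2 * δ ^ 2)) := by
  open MatrixConcentration in
  have hN0 : (0 : ℝ) < N := by exact_mod_cast hN
  have ha0 : 0 ≤ a := (norm_nonneg _).trans (ha ⟨0, hN⟩ ⟨0, hN⟩)
  let e : Fin (Fintype.card (UpperIndex N)) ≃ UpperIndex N := (Fintype.equivFin _).symm
  let μ : Fin (Fintype.card (UpperIndex N)) → Measure ℂ := fun k =>
    entryLaw (PR (e k).1.1 (e k).1.2) (PI (e k).1.1 (e k).1.2)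
  have hμ : ∀ k, IsProbabilityMeasure (μ k) := fun k =>
    have := hPR _ _ (e k).2
    have := hPI _ _ (e k).2
    isProbabilityMeasure_entryLaw
  let W : Ω → Fin (Fintype.card (UpperIndex N)) → ℂ := fun x k => ω (e k).1.1 (e k).1.2 x
  have hWk : ∀ k, AEMeasurable (fun x => W x k) P := fun k => (hlaw _ _ (e k).2).aemeasurable
  have hW : AEMeasurable W P := aemeasurable_pi_lambda _ hWk
  have hmap : P.map W = Measure.pi μ := by
    rw [(hind.precomp e.injective).map_fun_eq_pi_map hWk]
    congr 1
    funext k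
    exact (hlaw _ _ (e k).2).map_eq
  have hstat : ∀ (f : ℝ → ℝ) (x : Ω), spectralStat f A (fun i j => ω i j x) =
      (upperStat f A e (W x) : ℂ) := fun f x =>
    spectralStat_eq_upperStat e hA fun i j => hsa i j x
  refine ⟨fun K hK hPK f hfc hfL => ?_, fun c hc f hfL => ?_⟩
  · obtain ⟨L, hL⟩ := hfL
    have hL0 := lipConst_nonneg f
    have hΛ : 0 ≤ √2 * a * lipConst f / N := by positivity
    have hF := euclideanLipschitz_upperStat e hN hA ha hL
    have hFc := (hF.lipschitzWith hΛ).continuous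
    have hμK : ∀ k, μ k Kᶜ = 0 := fun k => hPK _ _ (e k).2
    obtain ⟨hint, hdev⟩ := integrable_and_deviation_of_map hW hmap hFc
      ((CompactlySupported.pi hK hμK).integrable hFc) (hstat f)
    refine ⟨hint, fun δ₀ hδ₀ δ hδ => ?_⟩
    have hδ₀0 : 0 ≤ δ₀ := by
      have := Metric.diam_nonneg (s := K)
      rw [hδ₀]; positivity
    set q := Metric.diam K ^ 2 * a ^ 2 * lipConst f ^ 2 with hq
    have hq16 : 16 * Metric.diam K ^ 2 * a ^ 2 * lipConst f ^ 2 = 16 * q := by rw [hq]; ring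
    rw [hq16]
    -- If `q = 0`, the exponent is `0` and the right side is `4`.
    rcases (show 0 ≤ q by positivity).eq_or_lt with hq0 | hq0
    · rw [← hq0]
      simp only [mul_zero, div_zero, neg_zero, zero_mul, Real.exp_zero, mul_one]
      exact measureReal_le_one.trans (by norm_num)
    have hD : 0 < Metric.diam K := by
      refine Metric.diam_nonneg.lt_of_ne fun h => ?_
      rw [hq, ← h] at hq0
      simp at hq0
    have hsub := hasSubgaussianMGF_of_convex hK hD
      (fun x hx y hy => by
        rw [← dist_eq_norm]
        exact Metric.dist_le_diam_of_mem hK.isBounded hx hy) μ hμK hΛ hF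
      (convexOn_upperStat e hA hfc)
    rw [hdev]
    refine (measureReal_le_abs_le_of_hasSubgaussianMGF hsub (hδ₀0.trans hδ.le)).trans ?_
    refine mul_le_mul (by norm_num) (Real.exp_le_exp.2 ?_) (Real.exp_pos _).le (by norm_num)
    rw [Real.coe_toNNReal _ (by positivity)]
    have hΛq : 2 * (2 * (√2 * a * lipConst f / N) ^ 2 * Metric.diam K ^ 2) = 8 * q / N ^ 2 := by
      rw [div_pow, mul_pow, mul_pow, Real.sq_sqrt (by norm_num), hq]; ring
    rw [hΛq]
    have h1 : -δ ^ 2 / (8 * q / N ^ 2) = -((N : ℝ) ^ 2 / (16 * q) * (2 * δ ^ 2)) := by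
      field_simp; ring
    have h2 : -(1 / (16 * q)) * (N : ℝ) ^ 2 * (δ - δ₀) ^ 2 =
        -((N : ℝ) ^ 2 / (16 * q) * (δ - δ₀) ^ 2) := by ring
    rw [h1, h2]
    refine neg_le_neg (mul_le_mul_of_nonneg_left ?_ (by positivity))
    -- The exponent obtained is twice as strong and unshifted: `(δ - δ₀)² ≤ 2 δ²` because `0 ≤ δ₀ <
    -- δ`.
    nlinarith
  · obtain ⟨L, hL⟩ := hfL
    have hL0 := lipConst_nonneg f
    have hΛ : 0 ≤ √2 * a * lipConst f / N := by positivity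
    have hF := euclideanLipschitz_upperStat e hN hA ha hL
    have hFc := (hF.lipschitzWith hΛ).continuous
    -- The sign of `c` is not given, whereas the sub-Gaussian bound needs a nonnegative constant.
    have hmono : ∀ (ν : Measure ℝ), LogSobolev ν c → LogSobolev ν (max c 0) := by
      intro ν h g h1 h2 h3
      refine (h g h1 h2 h3).trans (mul_le_mul_of_nonneg_right ?_
        (integral_nonneg fun _ => sq_nonneg _))
      linarith [le_max_left c 0]
    have hc0 : 0 ≤ max c 0 := le_max_right _ _
    have hLSI : GradientLSI (Measure.pi μ) (dualSq _) (max c 0) :=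
      gradientLSI_pi μ fun k =>
        have := hPR _ _ (e k).2
        have := hPI _ _ (e k).2
        (hmono _ (hc _ _ (e k).2).1).entryLaw (hmono _ (hc _ _ (e k).2).2)
    obtain ⟨hint, hdev⟩ := integrable_and_deviation_of_map hW hmap hFc
      (hLSI.integrable hc0 hΛ hF) (hstat f)
    refine ⟨hint, fun δ hδ => ?_⟩
    set q := c * a ^ 2 * lipConst f ^ 2 with hq
    have hq8 : 8 * c * a ^ 2 * lipConst f ^ 2 = 8 * q := by rw [hq]; ring
    rw [hq8]
    -- For `q ≤ 0` the exponent is nonnegative and the bound exceeds one.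
    rcases le_or_gt q 0 with hq0 | hq0
    · refine measureReal_le_one.trans ?_
      have h1 : 0 ≤ -(1 / (8 * q)) * (N : ℝ) ^ 2 * δ ^ 2 := by
        have : 1 / (8 * q) ≤ 0 := div_nonpos_of_nonneg_of_nonpos zero_le_one (by linarith)
        have : 0 ≤ -(1 / (8 * q)) := by linarith
        positivity
      linarith [Real.one_le_exp h1]
    have hcpos : 0 < c := by
      by_contra h
      have : q ≤ 0 := by
        rw [hq, mul_assoc]
        exact mul_nonpos_of_nonpos_of_nonneg (not_lt.1 h) (by positivity)
      linarith
    have hsub := hLSI.hasSubgaussianMGF hc0 hΛ hF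
    rw [hdev]
    refine (measureReal_le_abs_le_of_hasSubgaussianMGF hsub hδ.le).trans ?_
    refine mul_le_mul_of_nonneg_left (Real.exp_le_exp.2 ?_) (by norm_num)
    rw [Real.coe_toNNReal _ (by positivity), max_eq_left hcpos.le]
    have hΛq : 2 * (c * (√2 * a * lipConst f / N) ^ 2) = 4 * q / N ^ 2 := by
      rw [div_pow, mul_pow, mul_pow, Real.sq_sqrt (by norm_num), hq]; ring
    rw [hΛq]
    have h1 : -δ ^ 2 / (4 * q / N ^ 2) = -((N : ℝ) ^ 2 / (8 * q) * (2 * δ ^ 2)) := by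
      field_simp; norm_num
    have h2 : -(1 / (8 * q)) * (N : ℝ) ^ 2 * δ ^ 2 = -((N : ℝ) ^ 2 / (8 * q) * δ ^ 2) := by ring
    rw [h1, h2]
    refine neg_le_neg (mul_le_mul_of_nonneg_left ?_ (by positivity))
    nlinarith
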